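/- Let $q=e^{h}$ with $h\in\mathbb C$, $q^x:=e^{hx}$, $[x]:=(q^x-q^{-x})/(q-q^{-1})$, $[n]!:=[1][2]\cdots[n]$. Consider $U_q(su(2))$ with generators $J_\pm$, $q^{\pm J_0}$ and comultiplication $\Delta(q^{J_0})=q^{J_0}\otimes q^{J_0}$, $\Delta(J_\pm)=J_\pm\otimes q^{J_0}+q^{-J_0}\otimes J_\pm$. Fix square roots $\sqrt{[k]}$ of the numbers $[k]$, $k=0,1,2,\dots$; a square root of a product or quotient of $q$-numbers and $q$-factorials below means the corresponding product or quotient of these $\sqrt{[k]}$. The irreducible representation of spin $j\in\frac12\mathbb Z_{\ge0}$ has the canonical basis $|jm\rangle$, $m=-j,-j+1,\dots,j$, with $$q^{J_0}|jm\rangle=q^m|jm\rangle,\qquad J_\pm|jm\rangle=\sqrt{[j\mp m][j\pm m+1]}\,|j\,m\pm1\rangle .$$ Let $j_1,j_2,j_3\in\frac12\mathbb Z_{\ge0}$ with $j_1+j_2+j_3\in\mathbb Z$ and $|j_1-j_2|\le j_3\le j_1+j_2$, and suppose $q^2\ne1$ and $[k]\ne0$ for $1\le k\le j_1+j_2+j_3+1$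 (this holds whenever $q$ is not a root of unity). A coupled basis consists of vectors $|j_1j_2:j_3m_3\rangle_q=\sum_{m_1,m_2}(j_1m_1j_2m_2|j_3m_3)_q\,|j_1m_1\rangle|j_2m_2\rangle$ in $j_1\otimes j_2$, $m_3=-j_3,\dots,j_3$, which satisfy the canonical relations of spin $j_3$ with respect to $\Delta$, and which are orthonormal for the symmetric bilinear form in which the vectors $|j_1m_1\rangle|j_2m_2\rangle$ are orthonormal. The numbers $(j_1m_1j_2m_2|j_3m_3)_q$ are the Clebsch–Gordan coefficients. Let $$P^{j}_{m;j}=\sqrt{\frac{[j+m]!}{[2j]!\,[j-m]!}}\;J_-^{\,j-m}\,p,\qquad p=\sum_{n\ge0}\frac{(-1)^n}{[n]!\,\prod_{k=1}^{n}[2J_0+1+k]}\,J_-^nJ_+^n$$ be the general projection operator built from the extremal projector $p$, acting on vectors of weight $j$ (where $2J_0=2j$), and let $N_{m_1m_2m_3}=\langle j_1m_1|\langle j_2m_2|\Delta(P^{j_3}_{m_3;j_3})|j_1j_1\rangle|j_2\;j_3-j_1\rangle$ and $D=N_{j_1,\,j_3-j_1,\,j_3}$, where $\langle j_1m_1|\langle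 j_2m_2|$ is the dual basis. **(i)** A coupled basis exists. For each coupled basis there is a square root $s\neq 0$ of $D$ such that $(j_1m_1j_2m_2|j_3m_3)_q=N_{m_1m_2m_3}/s$ for all $m_1,m_2,m_3$, and there is a sign $\varepsilon\in\{1,-1\}$, independent of $m_1,m_2,m_3$, such that for all $m_1,m_2,m_3$ $$\begin{aligned}(j_1m_1j_2m_2|j_3m_3)_q&=\varepsilon\,\delta_{m_1+m_2,m_3}\,q^{-\frac12(j_1+j_2-j_3)(j_1+j_2+j_3+1)+j_1m_2-j_2m_1}\\&\times\sqrt{\frac{[2j_3+1][j_1+j_2-j_3]![j_1-j_2+j_3]![j_1+j_2+j_3+1]![j_2-m_2]![j_3+m_3]!}{[-j_1+j_2+j_3]![j_1+m_1]![j_1-m_1]![j_2+m_2]![j_3-m_3]!}}\\&\times\sum_n\frac{(-1)^{j_1+j_2-j_3-n}q^{n(j_1+m_1)}[2j_2-n]![j_1+j_2-m_3-n]!}{[n]![j_1+j_2-j_3-n]![j_2-m_2-n]![j_1+j_2+j_3+1-n]!},\end{aligned}$$ where the sum is over $0\le n\le\min(j_1+j_2-j_3,\,j_2-m_2)$; and,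 equivalently, $$\begin{aligned}(j_1m_1j_2m_2|j_3m_3)_q&=\varepsilon\,\delta_{m_1+m_2,m_3}\,q^{-\frac12(j_1+j_2-j_3)(j_1+j_2+j_3+1)+j_1m_2-j_2m_1}\\&\times(-1)^{j_1+j_2-j_3}\sqrt{\frac{[2j_3+1][j_1-j_2+j_3]!\,([2j_2]!)^2}{[j_1+j_2-j_3]![-j_1+j_2+j_3]![j_1+j_2+j_3+1]!}}\\&\times\sqrt{\frac{[j_3+m_3]!\,([j_1+j_2-m_3]!)^2}{[j_1+m_1]![j_1-m_1]![j_2+m_2]![j_2-m_2]![j_3-m_3]!}}\\&\times{}_3\Phi_2\!\left(\begin{matrix}-j_1-j_2+j_3,\,-j_1-j_2-j_3-1,\,-j_2+m_2\\-2j_2,\,-j_1-j_2+m_3\end{matrix}\,\middle|\,q^2,\,q^{2(j_1+m_1+1)}\right).\end{aligned}$$ Here ${}_3\Phi_2\!\left(\begin{smallmatrix}\alpha_1,\alpha_2,\alpha_3\\\beta_1,\beta_2\end{smallmatrix}\middle|q^2,z\right)=\sum_{n\ge0}\frac{(q^{2\alpha_1};q^2)_n(q^{2\alpha_2};q^2)_n(q^{2\alpha_3};q^2)_n}{(q^{2\beta_1};q^2)_n(q^{2\beta_2};q^2)_n(q^2;q^2)_n}z^n$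 with $(x;t)_n=\prod_{k=0}^{n-1}(1-xt^k)$, a terminating series (the terms with zero numerator are $0$). **(ii)** If $h$ is real (so $q>0$, $q\ne1$) and all $\sqrt{[k]}\ge0$, then $D>0$ and there is a coupled basis which is orthonormal for the Hermitian form in which the vectors $|j_1m_1\rangle|j_2m_2\rangle$ are orthonormal and which satisfies $(j_1\,j_1\,j_2\;j_3-j_1|j_3\,j_3)_q>0$; for every basis with these properties, $(j_1m_1j_2m_2|j_3m_3)_q=N_{m_1m_2m_3}/\sqrt D$ with $\sqrt D>0$, and both explicit formulas hold with $\varepsilon=1$. -/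

import Mathlib

open Matrix
open scoped Kronecker

noncomputable section

namespace UqSU2

/-! The complex deformation parameter is `q = exp h`, and `q ^ x = exp (h x)`.
A spin `j` is given by the natural number `a = 2 j`; the weights `m = -j, …, j` are indexed by
`i : Fin (a + 1)` through `i = j + m`. -/

/-- `q ^ x` for `q = exp h`. -/
def qpow (h : ℂ) (x : ℚ) : ℂ := Complex.exp (h * (x : ℂ))

/-- `[x] = (q ^ x - q ^ (-x)) / (q - q ^ (-1))`. -/
def qnum (h : ℂ) (x : ℚ) : ℂ := (qpow h x - qpow h (-x)) / (qpow h 1 - qpow h (-1))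

/-- `[x]! = [1][2]⋯[x]` for a natural number `x` (given as a rational number). -/
def qfact (h : ℂ) (x : ℚ) : ℂ := ∏ k ∈ Finset.range ⌊x⌋₊, qnum h ((k : ℚ) + 1)

/-- `√[x]! = √[1] √[2] ⋯ √[x]` for a natural number `x`, where `r k` is the chosen square root
of `[k]`. -/
def sqfact (r : ℕ → ℂ) (x : ℚ) : ℂ := ∏ k ∈ Finset.range ⌊x⌋₊, r (k + 1)

/-- The spin `j` with `2 j = a`. -/
def spin (a : ℕ) : ℚ := (a : ℚ) / 2

/-- The weight `m = i - j` of the basis vector with index `i`. -/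
def wt (a : ℕ) (i : Fin (a + 1)) : ℚ := ((i : ℕ) : ℚ) - spin a

/-! ### The irreducible representation of spin `j` and the tensor product -/

/-- The matrix of `q ^ (t J₀)` in the canonical basis: `q ^ (t J₀) |j m⟩ = q ^ (t m) |j m⟩`
(used for `t = 1` and `t = -1`). -/
def qJ0 (h : ℂ) (a : ℕ) (t : ℚ) : Matrix (Fin (a + 1)) (Fin (a + 1)) ℂ :=
  Matrix.diagonal fun i => qpow h (t * wt a i)

/-- The matrix of `J₊`: `J₊ |j m⟩ = √([j - m][j + m + 1]) |j m + 1⟩`. -/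
def Jplus (r : ℕ → ℂ) (a : ℕ) : Matrix (Fin (a + 1)) (Fin (a + 1)) ℂ :=
  Matrix.of fun k i =>
    if (k : ℕ) = (i : ℕ) + 1 then r (a - (i : ℕ)) * r ((i : ℕ) + 1) else 0

/-- The matrix of `J₋`: `J₋ |j m⟩ = √([j + m][j - m + 1]) |j m - 1⟩`. -/
def Jminus (r : ℕ → ℂ) (a : ℕ) : Matrix (Fin (a + 1)) (Fin (a + 1)) ℂ :=
  Matrix.of fun k i =>
    if (k : ℕ) + 1 = (i : ℕ) then r (i : ℕ) * r (a - (i : ℕ) + 1) else 0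

/-- `Δ(q ^ J₀) = q ^ J₀ ⊗ q ^ J₀` on `j₁ ⊗ j₂`, in the uncoupled basis `|j₁ m₁⟩ |j₂ m₂⟩`. -/
def deltaQJ0 (h : ℂ) (a b : ℕ) :
    Matrix (Fin (a + 1) × Fin (b + 1)) (Fin (a + 1) × Fin (b + 1)) ℂ :=
  qJ0 h a 1 ⊗ₖ qJ0 h b 1

/-- `Δ(J₊) = J₊ ⊗ q ^ J₀ + q ^ (-J₀) ⊗ J₊` on `j₁ ⊗ j₂`. -/
def deltaJplus (h : ℂ) (r : ℕ → ℂ) (a b : ℕ) :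
    Matrix (Fin (a + 1) × Fin (b + 1)) (Fin (a + 1) × Fin (b + 1)) ℂ :=
  Jplus r a ⊗ₖ qJ0 h b 1 + qJ0 h a (-1) ⊗ₖ Jplus r b

/-- `Δ(J₋) = J₋ ⊗ q ^ J₀ + q ^ (-J₀) ⊗ J₋` on `j₁ ⊗ j₂`. -/
def deltaJminus (h : ℂ) (r : ℕ → ℂ) (a b : ℕ) :
    Matrix (Fin (a + 1) × Fin (b + 1)) (Fin (a + 1) × Fin (b + 1)) ℂ :=
  Jminus r a ⊗ₖ qJ0 h b 1 + qJ0 h a (-1) ⊗ₖ Jminus r b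

/-- The vectors `v i` (`i = j + m`, `2 j = c`) satisfy the relations of the canonical basis of
the irreducible representation of spin `j` with respect to the operators `K = q ^ J₀`,
`E = J₊`, `F = J₋`:
`K |j m⟩ = q ^ m |j m⟩` and `J± |j m⟩ = √([j ∓ m][j ± m + 1]) |j m ± 1⟩`
(the right side being `0` when `m ± 1` is not a weight). -/
structure IsCanonicalBasis {ι : Type} [Fintype ι] (h : ℂ) (r : ℕ → ℂ) (c : ℕ)
    (K E F : Matrix ι ι ℂ) (v : Fin (c + 1) → ι → ℂ) : Prop where
  weight : ∀ i, K *ᵥ v i = qpow h (wt c i) • v i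
  raise : ∀ i, E *ᵥ v i =
    ∑ k : Fin (c + 1), if (k : ℕ) = (i : ℕ) + 1 then (r (c - (i : ℕ)) * r ((i : ℕ) + 1)) • v k else 0
  lower : ∀ i, F *ᵥ v i =
    ∑ k : Fin (c + 1), if (k : ℕ) + 1 = (i : ℕ) then (r (i : ℕ) * r (c - (i : ℕ) + 1)) • v k else 0

/-! ### The extremal projector and the general projection operator -/

/-- The extremal projector
`p = ∑ₙ (-1)ⁿ Γ(2J₀+2) / ([n]! Γ(2J₀+n+2)) J₋ⁿ J₊ⁿ` with `Γ(x+1) = [x] Γ(x)`, in the form in which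
it acts on the vectors of weight `μ`: there `Γ(2J₀+2) / Γ(2J₀+n+2)` is
`1 / ([2μ+2] ⋯ [2μ+n+1])`. The matrices `E = J₊`, `F = J₋` it is applied to are nilpotent, so the
terms with `n ≥ card ι` vanish. -/
def extremalProj {ι : Type} [Fintype ι] [DecidableEq ι] (h : ℂ) (μ : ℚ) (E F : Matrix ι ι ℂ) :
    Matrix ι ι ℂ :=
  ∑ n ∈ Finset.range (Fintype.card ι),
    ((-1) ^ n / (qfact h n * ∏ k ∈ Finset.range n, qnum h (2 * μ + 2 + k))) • (F ^ n * E ^ n)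

/-- `√([j+m]! / ([2j]! [j-m]!))` for `2 j = c`, `j + m = i`. -/
def ladderCoeff (r : ℕ → ℂ) (c : ℕ) (i : Fin (c + 1)) : ℂ :=
  sqfact r (spin c + wt c i) / (sqfact r (2 * spin c) * sqfact r (spin c - wt c i))

/-- The lowering operator `F^j_{m;j} = √([j+m]! / ([2j]! [j-m]!)) J₋^(j-m)`. -/
def lowering {ι : Type} [Fintype ι] [DecidableEq ι] (r : ℕ → ℂ) (c : ℕ) (i : Fin (c + 1))
    (F : Matrix ι ι ℂ) : Matrix ι ι ℂ :=
  ladderCoeff r c i • F ^ (c - (i : ℕ))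

/-- The rising operator `F^j_{j;m} = √([j+m]! / ([2j]! [j-m]!)) J₊^(j-m)`. -/
def rising {ι : Type} [Fintype ι] [DecidableEq ι] (r : ℕ → ℂ) (c : ℕ) (i : Fin (c + 1))
    (E : Matrix ι ι ℂ) : Matrix ι ι ℂ :=
  ladderCoeff r c i • E ^ (c - (i : ℕ))

/-- The general projection operator `P^j_{m;m'} = F^j_{m;j} p F^j_{j;m'}`, in the form in which it
acts on the vectors of weight `m'` (the rising operator takes them to weight `j`). -/
def genProj {ι : Type} [Fintype ι] [DecidableEq ι] (h : ℂ) (r : ℕ → ℂ) (c : ℕ)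
    (i i' : Fin (c + 1)) (E F : Matrix ι ι ℂ) : Matrix ι ι ℂ :=
  lowering r c i F * extremalProj h (spin c) E F * rising r c i' E

/-- The index of the uncoupled basis vector `|j₁ j₁⟩ |j₂ j₃ - j₁⟩`; the second component is
`j₂ + (j₃ - j₁)`. -/
def refIdx (a b c : ℕ) : Fin (a + 1) × Fin (b + 1) :=
  (Fin.last a, Fin.ofNat (b + 1) ((b + c - a) / 2))

/-- The matrix element
`⟨j₁ m₁| ⟨j₂ m₂| Δ(P^{j₃}_{m₃;j₃}) |j₁ j₁⟩ |j₂ j₃ - j₁⟩`. -/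
def projElem (h : ℂ) (r : ℕ → ℂ) (a b c : ℕ) (i₁ : Fin (a + 1)) (i₂ : Fin (b + 1))
    (i₃ : Fin (c + 1)) : ℂ :=
  genProj h r c i₃ (Fin.last c) (deltaJplus h r a b) (deltaJminus h r a b)
    (i₁, i₂) (refIdx a b c)

/-! ### Coupled bases

The Clebsch–Gordan coefficient `(j₁ m₁ j₂ m₂ | j₃ m₃)_q` is the coordinate `v i₃ (i₁, i₂)` of the
coupled basis vector `v i₃ = |j₁ j₂ : j₃ m₃⟩_q` at `|j₁ m₁⟩ |j₂ m₂⟩`. -/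

/-- A coupled basis `|j₁ j₂ : j₃ m₃⟩_q`, `m₃ = -j₃, …, j₃`: it satisfies the canonical relations of
spin `j₃` with respect to `Δ`, and it is orthonormal for the symmetric bilinear form in which the
uncoupled basis is orthonormal (and `J₊`, `J₋` are transposes of each other). -/
structure IsCoupledBasis (h : ℂ) (r : ℕ → ℂ) (a b c : ℕ)
    (v : Fin (c + 1) → Fin (a + 1) × Fin (b + 1) → ℂ) : Prop where
  canonical : IsCanonicalBasis h r c (deltaQJ0 h a b) (deltaJplus h r a b) (deltaJminus h r a b) v
  orthonormal : ∀ i k, v i ⬝ᵥ v k = if i = k then 1 else 0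

/-- The coupled basis for real `q > 0`: it satisfies the canonical relations of spin `j₃` with
respect to `Δ`, it is orthonormal for the Hermitian form in which the uncoupled basis is
orthonormal, and its phase is fixed by `(j₁ j₁ j₂ j₃-j₁ | j₃ j₃)_q > 0`. -/
structure IsUnitaryCoupledBasis (h : ℂ) (r : ℕ → ℂ) (a b c : ℕ)
    (v : Fin (c + 1) → Fin (a + 1) × Fin (b + 1) → ℂ) : Prop where
  canonical : IsCanonicalBasis h r c (deltaQJ0 h a b) (deltaJplus h r a b) (deltaJminus h r a b) v
  orthonormal : ∀ i k, star (v i) ⬝ᵥ v k = if i = k then 1 else 0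
  phase : 0 < (v (Fin.last c) (refIdx a b c)).re ∧ (v (Fin.last c) (refIdx a b c)).im = 0

/-! ### The explicit formulas -/

/-- The single-sum expression; the sum is over all `n ≥ 0` for which all the factorials are
factorials of nonnegative integers. -/
def cgSum (h : ℂ) (r : ℕ → ℂ) (j₁ m₁ j₂ m₂ j₃ m₃ : ℚ) : ℂ :=
  if m₁ + m₂ = m₃ then
    qpow h (-(1 / 2) * (j₁ + j₂ - j₃) * (j₁ + j₂ + j₃ + 1) + j₁ * m₂ - j₂ * m₁)
    * ((r ⌊2 * j₃ + 1⌋₊ * sqfact r (j₁ + j₂ - j₃) * sqfact r (j₁ - j₂ + j₃)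
          * sqfact r (j₁ + j₂ + j₃ + 1) * sqfact r (j₂ - m₂) * sqfact r (j₃ + m₃))
        / (sqfact r (-j₁ + j₂ + j₃) * sqfact r (j₁ + m₁) * sqfact r (j₁ - m₁)
          * sqfact r (j₂ + m₂) * sqfact r (j₃ - m₃)))
    * ∑ n ∈ Finset.range (⌊min (j₁ + j₂ - j₃) (j₂ - m₂)⌋₊ + 1),
        ((-1) ^ ⌊j₁ + j₂ - j₃ - n⌋₊ * qpow h (n * (j₁ + m₁))
          * qfact h (2 * j₂ - n) * qfact h (j₁ + j₂ - m₃ - n))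
        / (qfact h n * qfact h (j₁ + j₂ - j₃ - n) * qfact h (j₂ - m₂ - n)
          * qfact h (j₁ + j₂ + j₃ + 1 - n))
  else 0

/-- `(x; p)_n = ∏_{k<n} (1 - x p ^ k)`. -/
def qPoch (p x : ℂ) (n : ℕ) : ℂ := ∏ k ∈ Finset.range n, (1 - x * p ^ k)

/-- The basic hypergeometric series `₃Φ₂(x₁, x₂, x₃; y₁, y₂ | p, z)`; when it terminates, the
terms after the last nonzero numerator are `0`. -/
def phi32 (x₁ x₂ x₃ y₁ y₂ p z : ℂ) : ℂ :=
  ∑' n : ℕ, (qPoch p x₁ n * qPoch p x₂ n * qPoch p x₃ n)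
    / (qPoch p y₁ n * qPoch p y₂ n * qPoch p p n) * z ^ n

/-- The expression through `₃Φ₂` of base `q ^ 2`; a parameter `α` written in the exponent
convention stands for `q ^ (2 α)`. -/
def cgPhi (h : ℂ) (r : ℕ → ℂ) (j₁ m₁ j₂ m₂ j₃ m₃ : ℚ) : ℂ :=
  if m₁ + m₂ = m₃ then
    qpow h (-(1 / 2) * (j₁ + j₂ - j₃) * (j₁ + j₂ + j₃ + 1) + j₁ * m₂ - j₂ * m₁)
    * (-1) ^ ⌊j₁ + j₂ - j₃⌋₊
    * ((r ⌊2 * j₃ + 1⌋₊ * sqfact r (j₁ - j₂ + j₃) * qfact h (2 * j₂))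
        / (sqfact r (j₁ + j₂ - j₃) * sqfact r (-j₁ + j₂ + j₃) * sqfact r (j₁ + j₂ + j₃ + 1)))
    * ((sqfact r (j₃ + m₃) * qfact h (j₁ + j₂ - m₃))
        / (sqfact r (j₁ + m₁) * sqfact r (j₁ - m₁) * sqfact r (j₂ + m₂) * sqfact r (j₂ - m₂)
          * sqfact r (j₃ - m₃)))
    * phi32 (qpow h (2 * (-j₁ - j₂ + j₃))) (qpow h (2 * (-j₁ - j₂ - j₃ - 1)))
        (qpow h (2 * (-j₂ + m₂))) (qpow h (2 * (-2 * j₂))) (qpow h (2 * (-j₁ - j₂ + m₃)))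
        (qpow h 2) (qpow h (2 * (j₁ + m₁ + 1)))
  else 0

end UqSU2

end

namespace UqSU2

/-! ### Arithmetic of `q`-numbers -/

/-! Put M = j₁+j₂-j₃, A = -j₁+j₂+j₃, B = j₁-j₂+j₃. The triangle and parity conditions say exactly
that these are natural numbers; the spins become (M+B)/2, (M+A)/2, (A+B)/2, and the numbers assumed
nonzero are [1], …, [M+A+B+1].

Existence is proved by checking that the explicit coefficients themselves (`cgNat`, assembled into
the vectors `cgVec`) form a coupled basis. The J₋-relation holds term by term in the defining sum,
by the addition rule for q-numbers (`cgInner_lower`, `cgNat_lower`). For the highest weight vector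
the sum collapses to a product by a q-Vandermonde summation (`sum_alternating_vandermonde`,
`cgNat_top`); from the product one reads off that J₊ kills it, and a second summation
(`sum_convolution_vandermonde`) gives norm 1. A ladder generated by J₋ from a highest weight vector
satisfies all canonical relations (`isCanonicalBasis_of_lower`), and since J₊ and J₋ are transposes
of each other, unit norm passes down the ladder.

Uniqueness comes from the fact that a highest weight vector of weight j₃ is determined by one
coordinate, the one at |j₁ j₁⟩|j₂ j₃-j₁⟩ (`HasLevel.eq_zero_of_highest`). Hence canonical bases are
proportional, with one factor for the whole basis. Bilinear normalization makes the factor a sign;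
for real q the coefficients are real and the reference coordinate of `cgVec` is positive, so the
phase condition makes it 1.

For the projector, let v be the top vector of a coupled basis and e the reference basis vector.
Since J₊ p = 0 on weight j₃, p e is a multiple of v. Pairing with v removes every term of p except
the first, because J₋ moves to the other side as J₊; so p e = v(e) v. Applying the lowering operator
gives `projElem` = v i₃ (i₁, i₂) · v(e) (`IsCoupledBasis.projElem_eq`). In particular D = v(e)², and
s = v(e) is the required square root.

The sum and ₃Φ₂ formulas are then two rewritings of `cgNat`. -/

theorem qpow_zero (h : ℂ) : qpow h 0 = 1 := by simp [qpow]

theorem qpow_add (h : ℂ) (x y : ℚ) : qpow h (x + y) = qpow h x * qpow h y := by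
  simp only [qpow, ← Complex.exp_add]
  push_cast
  ring_nf

theorem qpow_ne_zero (h : ℂ) (x : ℚ) : qpow h x ≠ 0 := Complex.exp_ne_zero _

theorem qpow_neg (h : ℂ) (x : ℚ) : qpow h (-x) = (qpow h x)⁻¹ := by
  simp [qpow, ← Complex.exp_neg]

theorem qpow_mul_qpow_neg (h : ℂ) (x : ℚ) : qpow h x * qpow h (-x) = 1 := by
  rw [← qpow_add, add_neg_cancel, qpow_zero]

theorem qnum_zero (h : ℂ) : qnum h 0 = 0 := by simp [qnum]

theorem qnum_neg (h : ℂ) (x : ℚ) : qnum h (-x) = -qnum h x := by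
  simp only [qnum, neg_neg]
  ring

/-- The addition rule `[x + y] = [x] q ^ (-y) + q ^ x [y]`. -/
theorem qnum_add (h : ℂ) (x y : ℚ) :
    qnum h (x + y) = qnum h x * qpow h (-y) + qpow h x * qnum h y := by
  simp only [qnum, neg_add, qpow_add]
  ring

theorem qnum_add' (h : ℂ) (x y : ℚ) :
    qnum h (x + y) = qnum h x * qpow h y + qpow h (-x) * qnum h y := by
  rw [add_comm, qnum_add]
  ring

/-- This identity is the scalar content of [J₊, J₋] = [2J₀] and of all its iterates below. -/
theorem qnum_mul_sub_qnum_mul (h : ℂ) (x y : ℚ) :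
    qnum h x * qnum h (y + 1) - qnum h y * qnum h (x + 1) = qnum h (x - y) * qnum h 1 := by
  have e : x - y = x + -y := by ring
  rw [e]
  simp only [qnum, neg_add, qpow_add, neg_neg]
  ring

theorem sub_ne_zero_of_qnum_ne_zero {h : ℂ} {x : ℚ} (hx : qnum h x ≠ 0) :
    qpow h 1 - qpow h (-1) ≠ 0 := by
  intro h0
  simp [qnum, h0] at hx

theorem qnum_one {h : ℂ} (hd : qpow h 1 - qpow h (-1) ≠ 0) : qnum h 1 = 1 := div_self hd

theorem qnum_eq_zero_of_qpow_eq_one {h : ℂ} {x : ℚ} (hx : qpow h x = 1) : qnum h x = 0 := by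
  simp [qnum, qpow_neg, hx]

/-- `[n]!` for `n : ℕ`. -/
noncomputable def natQFact (h : ℂ) (n : ℕ) : ℂ := ∏ k ∈ Finset.range n, qnum h ((k : ℚ) + 1)

/-- `√[n]!` for `n : ℕ`. -/
def natSqFact (r : ℕ → ℂ) (n : ℕ) : ℂ := ∏ k ∈ Finset.range n, r (k + 1)

/-- The descending product `[x] [x - 1] ⋯ [x - n + 1]`. -/
noncomputable def qDescFact (h : ℂ) (x : ℚ) (n : ℕ) : ℂ :=
  ∏ k ∈ Finset.range n, qnum h (x - k)

theorem qfact_eq (h : ℂ) {x : ℚ} {n : ℕ} (hx : x = n) : qfact h x = natQFact h n := by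
  subst hx
  simp [qfact, natQFact]

theorem sqfact_eq (r : ℕ → ℂ) {x : ℚ} {n : ℕ} (hx : x = n) : sqfact r x = natSqFact r n := by
  subst hx
  simp [sqfact, natSqFact]

@[simp] theorem natQFact_zero (h : ℂ) : natQFact h 0 = 1 := by simp [natQFact]

theorem natQFact_succ (h : ℂ) (n : ℕ) :
    natQFact h (n + 1) = natQFact h n * qnum h ((n : ℚ) + 1) := by
  simp [natQFact, Finset.prod_range_succ]

@[simp] theorem natSqFact_zero (r : ℕ → ℂ) : natSqFact r 0 = 1 := by simp [natSqFact]

theorem natSqFact_succ (r : ℕ → ℂ) (n : ℕ) :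
    natSqFact r (n + 1) = natSqFact r n * r (n + 1) := by
  simp [natSqFact, Finset.prod_range_succ]

theorem natSqFact_sq {h : ℂ} {r : ℕ → ℂ} (hr : ∀ k : ℕ, r k ^ 2 = qnum h k) (n : ℕ) :
    natSqFact r n ^ 2 = natQFact h n := by
  simp only [natSqFact, natQFact, ← Finset.prod_pow, hr]
  simp

theorem natQFact_ne_zero {h : ℂ} {N n : ℕ} (hq : ∀ k : ℕ, 1 ≤ k → k ≤ N → qnum h k ≠ 0)
    (hn : n ≤ N) : natQFact h n ≠ 0 := by
  refine Finset.prod_ne_zero_iff.2 fun k hk => ?_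
  have := hq (k + 1) (by omega) (by have := Finset.mem_range.1 hk; omega)
  simpa using this

theorem natSqFact_ne_zero {r : ℕ → ℂ} {N n : ℕ} (hr0 : ∀ k : ℕ, 1 ≤ k → k ≤ N → r k ≠ 0)
    (hn : n ≤ N) : natSqFact r n ≠ 0 := by
  refine Finset.prod_ne_zero_iff.2 fun k hk => hr0 (k + 1) (by omega) ?_
  have := Finset.mem_range.1 hk
  omega

@[simp] theorem qDescFact_zero (h : ℂ) (x : ℚ) : qDescFact h x 0 = 1 := by simp [qDescFact]

theorem qDescFact_succ (h : ℂ) (x : ℚ) (n : ℕ) :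
    qDescFact h x (n + 1) = qDescFact h x n * qnum h (x - n) := by
  simp [qDescFact, Finset.prod_range_succ]

theorem qDescFact_add_one (h : ℂ) (x : ℚ) (n : ℕ) :
    qDescFact h (x + 1) n * qnum h (x + 1 - n) = qnum h (x + 1) * qDescFact h x n := by
  rw [← qDescFact_succ, qDescFact, Finset.prod_range_succ', mul_comm]
  simp [qDescFact]

/-- The product contains the factor [0]. Thus sums written up to M with a descending factorial stop
by themselves at j₂ - m₂. -/
theorem qDescFact_natCast_of_lt (h : ℂ) {l n : ℕ} (hn : l < n) : qDescFact h l n = 0 :=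
  Finset.prod_eq_zero (Finset.mem_range.2 hn) (by simp [qnum_zero])

theorem qDescFact_mul_natQFact (h : ℂ) {l n : ℕ} (hn : n ≤ l) :
    qDescFact h l n * natQFact h (l - n) = natQFact h l := by
  induction n with
  | zero => simp
  | succ n ih =>
    rw [← ih (by omega), qDescFact_succ]
    obtain ⟨d, rfl⟩ := Nat.exists_eq_add_of_lt hn
    rw [show n + d + 1 - n = d + 1 by omega, show n + d + 1 - (n + 1) = d by omega,
      natQFact_succ]
    push_cast
    rw [show (n + d + 1 - n : ℚ) = d + 1 by ring]
    ring

/-! ### Two `q`-Vandermonde summations -/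

/-- A terminating `₂Φ₁` summed by the `q`-Vandermonde formula. -/
theorem sum_alternating_vandermonde {h : ℂ} (B T : ℕ) : ∀ N : ℕ, T ≤ N →
    (∀ k : ℕ, 1 ≤ k → k ≤ N + B + 1 → qnum h k ≠ 0) →
    ∑ n ∈ Finset.range (T + 1), (-1) ^ n * qpow h (n * (B + T)) * natQFact h (N - n)
        / (natQFact h n * natQFact h (T - n) * natQFact h (N + B + 1 - n))
      = (-1) ^ T * qpow h (T * (N + B + 1)) * (natQFact h (B + T) * natQFact h (N - T))
        / (natQFact h B * natQFact h T * natQFact h (N + B + 1)) := by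
  induction T with
  | zero =>
    intro N _ hq
    have := natQFact_ne_zero hq (show B ≤ N + B + 1 by omega)
    simp [qpow_zero]
    field_simp
  | succ T ih =>
    intro N hN hq
    obtain ⟨N, rfl⟩ : ∃ N', N = N' + 1 := ⟨N - 1, by omega⟩
    have hT : qnum h ((T : ℚ) + 1) ≠ 0 := by
      simpa using hq (T + 1) (by omega) (by omega)
    have nz : ∀ n, n ≤ N + 1 + B + 1 → natQFact h n ≠ 0 := fun n => natQFact_ne_zero hq
    have ih1 := ih (N + 1) (by omega) hq
    have ih2 := ih N (by omega) fun k h1 h2 => hq k h1 (by omega)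
    -- Pascal-type recursion: splitting [T+1] = [T+1-n] q^(-n) + q^(T+1-n) [n] cancels a factor of
    -- [T+1-n]! in the first part and of [n]! in the second. Shifting n in the second part leaves
    -- two instances of the statement for T, with upper arguments N+1 and N.
    have key : qnum h ((T : ℚ) + 1) * ∑ n ∈ Finset.range (T + 1 + 1),
          (-1) ^ n * qpow h (n * (B + (T + 1 : ℕ))) * natQFact h (N + 1 - n)
          / (natQFact h n * natQFact h (T + 1 - n) * natQFact h (N + 1 + B + 1 - n))
        = (∑ n ∈ Finset.range (T + 1), (-1) ^ n * qpow h (n * (B + T)) * natQFact h (N + 1 - n)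
          / (natQFact h n * natQFact h (T - n) * natQFact h (N + 1 + B + 1 - n)))
        - qpow h (B + 2 * T + 1) * ∑ n ∈ Finset.range (T + 1),
          (-1) ^ n * qpow h (n * (B + T)) * natQFact h (N - n)
          / (natQFact h n * natQFact h (T - n) * natQFact h (N + B + 1 - n)) := by
      have split : ∀ n ∈ Finset.range (T + 1 + 1), qnum h ((T : ℚ) + 1) *
          ((-1) ^ n * qpow h (n * (B + (T + 1 : ℕ))) * natQFact h (N + 1 - n)
          / (natQFact h n * natQFact h (T + 1 - n) * natQFact h (N + 1 + B + 1 - n)))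
          = (qnum h ((T : ℚ) + 1 - n) * ((-1) ^ n * qpow h (n * (B + T)) * natQFact h (N + 1 - n)
          / (natQFact h n * natQFact h (T + 1 - n) * natQFact h (N + 1 + B + 1 - n))))
          + (qnum h n * ((-1) ^ n * qpow h (n * (B + T) + (T + 1)) * natQFact h (N + 1 - n)
          / (natQFact h n * natQFact h (T + 1 - n) * natQFact h (N + 1 + B + 1 - n)))) := by
        intro n hn
        have e1 : qnum h ((T : ℚ) + 1) = qnum h ((T : ℚ) + 1 - n) * qpow h (-n)
            + qpow h ((T : ℚ) + 1 - n) * qnum h n := by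
          rw [← qnum_add]
          ring_nf
        have e2 : qpow h (n * (B + T)) = qpow h (-n) * qpow h (n * (B + (T + 1 : ℕ))) := by
          rw [← qpow_add]
          push_cast
          ring_nf
        have e3 : qpow h (n * (B + T) + (T + 1))
            = qpow h ((T : ℚ) + 1 - n) * qpow h (n * (B + (T + 1 : ℕ))) := by
          rw [← qpow_add]
          push_cast
          ring_nf
        rw [e1, e2, e3]
        ring
      rw [Finset.mul_sum, Finset.sum_congr rfl split, Finset.sum_add_distrib,
        Finset.sum_range_succ, Finset.sum_range_succ' (fun n : ℕ => qnum h n * _)]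
      push_cast
      rw [sub_self, qnum_zero, zero_mul, zero_mul, add_zero, add_zero,
        sub_eq_add_neg (Finset.sum _ _) _, ← neg_mul, Finset.mul_sum]
      congr 1
      · refine Finset.sum_congr rfl fun n hn => ?_
        have hn' := Finset.mem_range.1 hn
        obtain ⟨d, rfl⟩ : ∃ d, T = n + d := ⟨T - n, by omega⟩
        rw [show n + d + 1 - n = d + 1 by omega, show n + d - n = d by omega, natQFact_succ]
        push_cast at hq ⊢
        rw [show (n + d + 1 - n : ℚ) = d + 1 by ring]
        have := nz d (by omega)
        have := nz n (by omega)
        have := nz (N + 1 + B + 1 - n) (by omega)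
        have : qnum h ((d : ℚ) + 1) ≠ 0 := by simpa using hq (d + 1) (by omega) (by omega)
        field_simp
      · refine Finset.sum_congr rfl fun n hn => ?_
        have hn' := Finset.mem_range.1 hn
        rw [show N + 1 + B - n = N + B + 1 - n by omega, natQFact_succ]
        have e : qpow h (((n : ℚ) + 1) * (B + T) + (T + 1))
            = qpow h (B + 2 * T + 1) * qpow h (n * (B + T)) := by
          rw [← qpow_add]
          ring_nf
        rw [e]
        have := nz (T - n) (by omega)
        have := nz n (by omega)
        have := nz (N + B + 1 - n) (by omega)
        have : qnum h ((n : ℚ) + 1) ≠ 0 := by simpa using hq (n + 1) (by omega) (by omega)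
        field_simp
        ring
    refine mul_left_cancel₀ hT (key.trans ?_)
    rw [ih1, ih2]
    obtain ⟨d, rfl⟩ : ∃ d, N = T + d := ⟨N - T, by omega⟩
    rw [show T + d + 1 - T = d + 1 by omega, show T + d + 1 - (T + 1) = d by omega,
      show T + d - T = d by omega, show T + d + 1 + B + 1 = (T + d + B + 1) + 1 by omega,
      show B + (T + 1) = B + T + 1 by omega]
    simp only [natQFact_succ h d, natQFact_succ h T, natQFact_succ h (B + T),
      natQFact_succ h (T + d + B + 1)]
    have := nz T (by omega)
    have := nz B (by omega)
    have := nz (T + d + B + 1) (by omega)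
    have hz : qnum h (((T + d + B + 1 : ℕ) : ℚ) + 1) ≠ 0 := by
      simpa using hq (T + d + B + 1 + 1) (by omega) (by omega)
    push_cast at hz ⊢
    set z := qnum h ((T + d + B + 1 : ℚ) + 1) with hzdef
    have e1 : qpow h (((T : ℚ) + 1) * ((T : ℚ) + d + 1 + B + 1))
        = qpow h (T * (T + d + B + 1)) * qpow h (B + 2 * T + 1) * qpow h (d + 1) := by
      rw [← qpow_add, ← qpow_add]
      ring_nf
    have e2 : qpow h ((T : ℚ) * ((T : ℚ) + d + 1 + B + 1))
        = qpow h (T * (T + d + B + 1)) * qpow h T := by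
      rw [← qpow_add]
      ring_nf
    -- After cancelling common factors, the induction step is the addition rule for [(d+1) +
    -- (B+T+1)].
    have id1 : qpow h T * qnum h ((d : ℚ) + 1) - qpow h (B + 2 * T + 1) * z
        = - (qpow h (B + 2 * T + 1) * qpow h (d + 1) * qnum h (B + T + 1)) := by
      have : z = qnum h ((d + 1 : ℚ) + (B + T + 1)) := by rw [hzdef]; ring_nf
      rw [this, qnum_add h (d + 1)]
      have e3 : qpow h (T : ℚ) = qpow h (B + 2 * T + 1) * qpow h (-(B + T + 1)) := by
        rw [← qpow_add]
        ring_nf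
      rw [e3]
      ring
    rw [e1, e2, pow_succ]
    field_simp
    linear_combination (norm := ring_nf) qpow h (T * (T + d + B + 1)) * natQFact h (B + T) * natQFact h d * id1

/-- The `q`-Vandermonde convolution of two `q`-binomial coefficients with running upper index. -/
theorem sum_convolution_vandermonde {h : ℂ} (M : ℕ) : ∀ A B : ℕ,
    (∀ k : ℕ, 1 ≤ k → k ≤ A + B + M + 1 → qnum h k ≠ 0) →
    ∑ T ∈ Finset.range (M + 1), qpow h (T * (A + 1) - (M - T) * (B + 1))
        * (natQFact h (B + T) * natQFact h (A + (M - T)) / (natQFact h T * natQFact h (M - T)))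
      = natQFact h A * natQFact h B * natQFact h (A + B + M + 1)
        / (natQFact h M * natQFact h (A + B + 1)) := by
  induction M with
  | zero =>
    intro A B hq
    have := natQFact_ne_zero hq (show A + B + 1 ≤ A + B + 0 + 1 by omega)
    simp [qpow_zero]
    field_simp
  | succ M ih =>
    intro A B hq
    have hM : qnum h ((M : ℚ) + 1) ≠ 0 := by
      simpa using hq (M + 1) (by omega) (by omega)
    have nz : ∀ n, n ≤ A + B + (M + 1) + 1 → natQFact h n ≠ 0 := fun n => natQFact_ne_zero hq
    have ih1 := ih A (B + 1) fun k h1 h2 => hq k h1 (by omega)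
    have ih2 := ih (A + 1) B fun k h1 h2 => hq k h1 (by omega)
    -- Here [M+1] = [M+1-T] q^T + q^(-(M+1-T)) [T]. The two parts are the sums for M with (A+1, B)
    -- and (A, B+1), which is why the induction keeps A and B general.
    have key : qnum h ((M : ℚ) + 1) * ∑ T ∈ Finset.range (M + 1 + 1),
          qpow h (T * (A + 1) - ((M + 1 : ℕ) - T) * (B + 1))
          * (natQFact h (B + T) * natQFact h (A + (M + 1 - T))
            / (natQFact h T * natQFact h (M + 1 - T)))
        = qpow h (-(B + 1)) * (∑ T ∈ Finset.range (M + 1),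
          qpow h (T * ((A + 1 : ℕ) + 1) - (M - T) * (B + 1))
          * (natQFact h (B + T) * natQFact h (A + 1 + (M - T))
            / (natQFact h T * natQFact h (M - T))))
        + qpow h (A + 1) * ∑ T ∈ Finset.range (M + 1),
          qpow h (T * (A + 1) - (M - T) * ((B + 1 : ℕ) + 1))
          * (natQFact h (B + 1 + T) * natQFact h (A + (M - T))
            / (natQFact h T * natQFact h (M - T))) := by
      have split : ∀ T ∈ Finset.range (M + 1 + 1), qnum h ((M : ℚ) + 1) *
          (qpow h (T * (A + 1) - ((M + 1 : ℕ) - T) * (B + 1))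
          * (natQFact h (B + T) * natQFact h (A + (M + 1 - T))
            / (natQFact h T * natQFact h (M + 1 - T))))
          = qnum h ((M : ℚ) + 1 - T) * (qpow h (T + (T * (A + 1) - (M + 1 - T) * (B + 1)))
          * (natQFact h (B + T) * natQFact h (A + (M + 1 - T))
            / (natQFact h T * natQFact h (M + 1 - T))))
          + qnum h T * (qpow h (-(M + 1 - T) + (T * (A + 1) - (M + 1 - T) * (B + 1)))
          * (natQFact h (B + T) * natQFact h (A + (M + 1 - T))
            / (natQFact h T * natQFact h (M + 1 - T)))) := by
        intro T _
        have e1 : qnum h ((M : ℚ) + 1) = qnum h ((M : ℚ) + 1 - T) * qpow h T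
            + qpow h (-((M : ℚ) + 1 - T)) * qnum h T := by
          rw [← qnum_add']
          ring_nf
        rw [e1, qpow_add h (T : ℚ), qpow_add h (-((M : ℚ) + 1 - T))]
        push_cast
        ring
      rw [Finset.mul_sum, Finset.sum_congr rfl split, Finset.sum_add_distrib,
        Finset.sum_range_succ, Finset.sum_range_succ' (fun n : ℕ => qnum h n * _)]
      push_cast
      rw [sub_self, qnum_zero, zero_mul, zero_mul, add_zero, add_zero, Finset.mul_sum,
        Finset.mul_sum]
      congr 1
      · refine Finset.sum_congr rfl fun n hn => ?_
        have hn' := Finset.mem_range.1 hn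
        obtain ⟨d, rfl⟩ : ∃ d, M = n + d := ⟨M - n, by omega⟩
        rw [show n + d + 1 - n = d + 1 by omega, show n + d - n = d by omega,
          natQFact_succ h d, show A + 1 + d = A + (d + 1) by omega]
        push_cast
        rw [show (n + d + 1 - n : ℚ) = d + 1 by ring, show (n + d - n : ℚ) = d by ring]
        have e : qpow h (n + (n * (A + 1) - (d + 1) * (B + 1)))
            = qpow h (-(B + 1)) * qpow h (n * (A + 1 + 1) - d * (B + 1)) := by
          rw [← qpow_add]
          ring_nf
        rw [e]
        have := nz d (by omega)
        have := nz n (by omega)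
        have : qnum h ((d : ℚ) + 1) ≠ 0 := by simpa using hq (d + 1) (by omega) (by omega)
        field_simp
      · refine Finset.sum_congr rfl fun n hn => ?_
        have hn' := Finset.mem_range.1 hn
        rw [show B + (n + 1) = B + 1 + n by omega,
          natQFact_succ h n]
        have e : qpow h (-(M + 1 - (n + 1)) + ((n + 1) * (A + 1) - (M + 1 - (n + 1)) * (B + 1)))
            = qpow h (A + 1) * qpow h (n * (A + 1) - (M - n) * (B + 1 + 1)) := by
          rw [← qpow_add]
          ring_nf
        rw [e]
        have := nz (M - n) (by omega)
        have := nz n (by omega)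
        have : qnum h ((n : ℚ) + 1) ≠ 0 := by simpa using hq (n + 1) (by omega) (by omega)
        field_simp
    refine mul_left_cancel₀ hM (key.trans ?_)
    rw [ih1, ih2, show A + 1 + B + M + 1 = A + B + (M + 1) + 1 by omega,
      show A + (B + 1) + M + 1 = A + B + (M + 1) + 1 by omega,
      show A + 1 + B + 1 = A + B + 1 + 1 by omega, show A + (B + 1) + 1 = A + B + 1 + 1 by omega,
      natQFact_succ h A, natQFact_succ h B, natQFact_succ h M, natQFact_succ h (A + B + 1)]
    have := nz M (by omega)
    have := nz (A + B + 1) (by omega)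
    have hz : qnum h (((A + B + 1 : ℕ) : ℚ) + 1) ≠ 0 := by
      simpa using hq (A + B + 1 + 1) (by omega) (by omega)
    have id1 : qnum h (((A + B + 1 : ℕ) : ℚ) + 1)
        = qpow h (-(B + 1)) * qnum h (A + 1) + qpow h (A + 1) * qnum h (B + 1) := by
      have e : (((A + B + 1 : ℕ) : ℚ) + 1) = (A + 1) + (B + 1) := by
        push_cast
        ring
      rw [e, qnum_add h ((A : ℚ) + 1)]
      ring
    field_simp
    rw [id1]

/-! ### The tensor product of two irreducible representations -/

/-- The ladder coefficients therefore vanish at both ends, so general formulas remain valid there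
even when the neighbouring index is out of range. -/
theorem sqrt_zero {h : ℂ} {r : ℕ → ℂ} (hr : ∀ k : ℕ, r k ^ 2 = qnum h k) : r 0 = 0 := by
  have := hr 0
  rwa [Nat.cast_zero, qnum_zero, sq_eq_zero_iff] at this

theorem sum_ite_val_add_one_eq {V : Type*} [AddCommMonoid V] {c n : ℕ} (hn : n < c)
    (f : Fin (c + 1) → V) :
    (∑ k : Fin (c + 1), if (k : ℕ) + 1 = n + 1 then f k else 0) = f ⟨n, by omega⟩ := by
  rw [Finset.sum_eq_single ⟨n, by omega⟩]
  · simp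
  · intro k _ hk
    rw [if_neg]
    intro h
    exact hk (Fin.ext (by simpa using h))
  · simp

theorem sum_ite_val_eq_add_one {V : Type*} [AddCommMonoid V] {c n : ℕ} (hn : n < c)
    (f : Fin (c + 1) → V) :
    (∑ k : Fin (c + 1), if (k : ℕ) = n + 1 then f k else 0) = f ⟨n + 1, by omega⟩ := by
  rw [Finset.sum_eq_single ⟨n + 1, by omega⟩]
  · simp
  · intro k _ hk
    rw [if_neg]
    intro h
    exact hk (Fin.ext (by simpa using h))
  · simp

theorem Jplus_mulVec_zero (r : ℕ → ℂ) (a : ℕ) (y : Fin (a + 1) → ℂ) :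
    (Jplus r a *ᵥ y) 0 = 0 := by
  simp [Matrix.mulVec, dotProduct, Jplus]

theorem Jplus_mulVec_succ (r : ℕ → ℂ) {a n : ℕ} (hn : n < a) (y : Fin (a + 1) → ℂ) :
    (Jplus r a *ᵥ y) ⟨n + 1, by omega⟩ = r (a - n) * r (n + 1) * y ⟨n, by omega⟩ := by
  simp only [Matrix.mulVec, dotProduct, Jplus, Matrix.of_apply, ite_mul, zero_mul]
  simp only [eq_comm (a := n + 1)]
  rw [sum_ite_val_add_one_eq hn fun k : Fin (a + 1) => r (a - k) * r (k + 1) * y k]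

theorem Jminus_mulVec_of_lt (r : ℕ → ℂ) {a n : ℕ} (hn : n < a) (y : Fin (a + 1) → ℂ) :
    (Jminus r a *ᵥ y) ⟨n, by omega⟩ = r (n + 1) * r (a - n) * y ⟨n + 1, by omega⟩ := by
  simp only [Matrix.mulVec, dotProduct, Jminus, Matrix.of_apply, ite_mul, zero_mul]
  simp only [eq_comm (a := n + 1)]
  rw [sum_ite_val_eq_add_one hn fun k : Fin (a + 1) => r k * r (a - k + 1) * y k]
  simp only
  rw [show a - (n + 1) + 1 = a - n by omega]

theorem Jminus_mulVec_last (r : ℕ → ℂ) (a : ℕ) (y : Fin (a + 1) → ℂ) :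
    (Jminus r a *ᵥ y) (Fin.last a) = 0 := by
  simp only [Matrix.mulVec, dotProduct, Jminus, Matrix.of_apply, ite_mul, zero_mul]
  refine Finset.sum_eq_zero fun k _ => if_neg ?_
  have := k.2
  simp only [Fin.val_last]
  omega

theorem Jplus_transpose (r : ℕ → ℂ) (a : ℕ) : (Jplus r a)ᵀ = Jminus r a := by
  ext k i
  simp only [Matrix.transpose_apply, Jplus, Jminus, Matrix.of_apply, eq_comm (a := (i : ℕ))]
  split_ifs with h
  · rw [← h, show a - ((k : ℕ) + 1) + 1 = a - k by have := i.2; omega, mul_comm]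
  · rfl

theorem kronecker_diagonal_mulVec {m n : Type*} [Fintype m] [Fintype n] [DecidableEq n]
    (X : Matrix m m ℂ) (d : n → ℂ) (x : m × n → ℂ) (p : m × n) :
    ((X ⊗ₖ Matrix.diagonal d) *ᵥ x) p = d p.2 * (X *ᵥ fun j => x (j, p.2)) p.1 := by
  simp only [Matrix.mulVec, dotProduct, Matrix.kroneckerMap_apply, Fintype.sum_prod_type,
    Finset.mul_sum]
  refine Finset.sum_congr rfl fun j _ => ?_
  rw [Finset.sum_eq_single p.2]
  · simp
    ring
  · intro k _ hk
    simp [Matrix.diagonal_apply_ne' _ hk]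
  · simp

theorem diagonal_kronecker_mulVec {m n : Type*} [Fintype m] [Fintype n] [DecidableEq m]
    (X : Matrix n n ℂ) (d : m → ℂ) (x : m × n → ℂ) (p : m × n) :
    ((Matrix.diagonal d ⊗ₖ X) *ᵥ x) p = d p.1 * (X *ᵥ fun j => x (p.1, j)) p.2 := by
  simp only [Matrix.mulVec, dotProduct, Matrix.kroneckerMap_apply, Fintype.sum_prod_type_right,
    Finset.mul_sum]
  refine Finset.sum_congr rfl fun j _ => ?_
  rw [Finset.sum_eq_single p.1]
  · simp
    ring
  · intro k _ hk
    simp [Matrix.diagonal_apply_ne' _ hk]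
  · simp

theorem deltaJplus_mulVec (h : ℂ) (r : ℕ → ℂ) (a b : ℕ) (x : Fin (a + 1) × Fin (b + 1) → ℂ)
    (p : Fin (a + 1) × Fin (b + 1)) :
    (deltaJplus h r a b *ᵥ x) p = qpow h (wt b p.2) * (Jplus r a *ᵥ fun j => x (j, p.2)) p.1
      + qpow h (-wt a p.1) * (Jplus r b *ᵥ fun j => x (p.1, j)) p.2 := by
  simp only [deltaJplus, qJ0, Matrix.add_mulVec, Pi.add_apply, kronecker_diagonal_mulVec,
    diagonal_kronecker_mulVec, one_mul, neg_mul]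

theorem deltaJminus_mulVec (h : ℂ) (r : ℕ → ℂ) (a b : ℕ) (x : Fin (a + 1) × Fin (b + 1) → ℂ)
    (p : Fin (a + 1) × Fin (b + 1)) :
    (deltaJminus h r a b *ᵥ x) p = qpow h (wt b p.2) * (Jminus r a *ᵥ fun j => x (j, p.2)) p.1
      + qpow h (-wt a p.1) * (Jminus r b *ᵥ fun j => x (p.1, j)) p.2 := by
  simp only [deltaJminus, qJ0, Matrix.add_mulVec, Pi.add_apply, kronecker_diagonal_mulVec,
    diagonal_kronecker_mulVec, one_mul, neg_mul]

theorem deltaQJ0_mulVec (h : ℂ) (a b : ℕ) (x : Fin (a + 1) × Fin (b + 1) → ℂ)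
    (p : Fin (a + 1) × Fin (b + 1)) :
    (deltaQJ0 h a b *ᵥ x) p = qpow h (wt a p.1 + wt b p.2) * x p := by
  simp only [deltaQJ0, qJ0, kronecker_diagonal_mulVec, Matrix.mulVec_diagonal, one_mul, qpow_add]
  ring

/-- This adjointness for the bilinear form is the source of both norm propagation and the evaluation
of the projector. -/
theorem deltaJplus_transpose (h : ℂ) (r : ℕ → ℂ) (a b : ℕ) :
    (deltaJplus h r a b)ᵀ = deltaJminus h r a b := by
  simp [deltaJplus, deltaJminus, qJ0, ← Jplus_transpose, ← Matrix.kroneckerMap_transpose]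

theorem deltaJminus_transpose (h : ℂ) (r : ℕ → ℂ) (a b : ℕ) :
    (deltaJminus h r a b)ᵀ = deltaJplus h r a b := by
  rw [← deltaJplus_transpose, Matrix.transpose_transpose]

/-! ### Commutation relations -/

theorem qJ0_mul_Jplus (h : ℂ) (r : ℕ → ℂ) (a : ℕ) (t : ℚ) :
    qJ0 h a t * Jplus r a = qpow h t • (Jplus r a * qJ0 h a t) := by
  ext k i
  simp only [qJ0, Matrix.diagonal_mul, Matrix.smul_apply, Matrix.mul_diagonal, smul_eq_mul,
    Jplus, Matrix.of_apply]
  split_ifs with hk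
  · have : wt a k = wt a i + 1 := by
      simp only [wt, hk]
      push_cast
      ring
    rw [this, mul_add, mul_one, qpow_add]
    ring
  · simp

theorem qJ0_mul_Jminus (h : ℂ) (r : ℕ → ℂ) (a : ℕ) (t : ℚ) :
    qJ0 h a t * Jminus r a = qpow h (-t) • (Jminus r a * qJ0 h a t) := by
  ext k i
  simp only [qJ0, Matrix.diagonal_mul, Matrix.smul_apply, Matrix.mul_diagonal, smul_eq_mul,
    Jminus, Matrix.of_apply]
  split_ifs with hk
  · have : t * wt a k = -t + t * wt a i := by
      simp only [wt, ← hk]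
      push_cast
      ring
    rw [this, qpow_add]
    ring
  · simp

/-- Both products are diagonal, with entries [k][a-k+1] and [a-k][k+1]; the factor [0] accounts for
the ends of the ladder. -/
theorem Jplus_mul_Jminus_sub {h : ℂ} {r : ℕ → ℂ} (hr : ∀ k : ℕ, r k ^ 2 = qnum h k)
    (h1 : qnum h 1 = 1) (a : ℕ) :
    Jplus r a * Jminus r a - Jminus r a * Jplus r a
      = Matrix.diagonal fun i => qnum h (2 * wt a i) := by
  have key : ∀ (k : Fin (a + 1)) (y : Fin (a + 1) → ℂ),
      (Jplus r a *ᵥ (Jminus r a *ᵥ y)) k = qnum h k * qnum h ((a : ℚ) - k + 1) * y k := by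
    rintro ⟨k, hk⟩ y
    rcases k with _ | n
    · exact (Jplus_mulVec_zero r a _).trans (by simp [qnum_zero])
    · rw [Jplus_mulVec_succ r (by omega), Jminus_mulVec_of_lt r (by omega)]
      have e : (a : ℚ) - (n + 1 : ℕ) + 1 = (a - n : ℕ) := by
        rw [Nat.cast_sub (by omega)]
        push_cast
        ring
      simp only
      rw [e, ← hr, ← hr]
      ring
  have key' : ∀ (k : Fin (a + 1)) (y : Fin (a + 1) → ℂ),
      (Jminus r a *ᵥ (Jplus r a *ᵥ y)) k = qnum h ((a : ℚ) - k) * qnum h (k + 1) * y k := by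
    rintro ⟨k, hk⟩ y
    rcases Nat.lt_succ_iff_lt_or_eq.1 hk with hn | rfl
    · rw [Jminus_mulVec_of_lt r hn, Jplus_mulVec_succ r hn]
      have e : (a : ℚ) - k = (a - k : ℕ) := by
        rw [Nat.cast_sub (by omega)]
      have e' : (k : ℚ) + 1 = (k + 1 : ℕ) := by
        push_cast
        ring
      simp only
      rw [e, e', ← hr, ← hr]
      ring
    · exact (Jminus_mulVec_last r k _).trans (by simp [qnum_zero])
  refine Matrix.ext_of_mulVec_single fun i => ?_
  ext k
  rw [Matrix.sub_mulVec, ← Matrix.mulVec_mulVec, ← Matrix.mulVec_mulVec, Pi.sub_apply, key, key',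
    Matrix.mulVec_diagonal, ← sub_mul]
  congr 1
  rw [qnum_mul_sub_qnum_mul, h1, mul_one]
  congr 1
  simp only [wt, spin]
  ring

/-- The mixed terms cancel, since moving q^(±J₀) past J± produces the same factor in both orders.
What remains is [2J₀] ⊗ q^(2J₀) + q^(-2J₀) ⊗ [2J₀], which is the addition rule for [2J₀ ⊗ 1 + 1 ⊗
2J₀]. -/
theorem deltaJplus_mul_deltaJminus_sub {h : ℂ} {r : ℕ → ℂ} (hr : ∀ k : ℕ, r k ^ 2 = qnum h k)
    (h1 : qnum h 1 = 1) (a b : ℕ) :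
    deltaJplus h r a b * deltaJminus h r a b - deltaJminus h r a b * deltaJplus h r a b
      = Matrix.diagonal fun p => qnum h (2 * (wt a p.1 + wt b p.2)) := by
  have e1 : Jplus r a * Jminus r a
      = Jminus r a * Jplus r a + Matrix.diagonal fun i => qnum h (2 * wt a i) := by
    rw [← Jplus_mul_Jminus_sub hr h1 a]
    abel
  have e2 : Jplus r b * Jminus r b
      = Jminus r b * Jplus r b + Matrix.diagonal fun i => qnum h (2 * wt b i) := by
    rw [← Jplus_mul_Jminus_sub hr h1 b]
    abel
  have e3 : (Matrix.diagonal fun p : Fin (a + 1) × Fin (b + 1) =>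
        qnum h (2 * (wt a p.1 + wt b p.2)))
      = (Matrix.diagonal fun i => qnum h (2 * wt a i)) ⊗ₖ (qJ0 h b 1 * qJ0 h b 1)
        + (qJ0 h a (-1) * qJ0 h a (-1)) ⊗ₖ Matrix.diagonal fun i => qnum h (2 * wt b i) := by
    simp only [qJ0, Matrix.diagonal_mul_diagonal, Matrix.diagonal_kronecker_diagonal,
      Matrix.diagonal_add, ← qpow_add]
    congr 1
    ext p
    rw [mul_add, qnum_add']
    ring_nf
  rw [e3]
  simp only [deltaJplus, deltaJminus, mul_add, add_mul, ← Matrix.mul_kronecker_mul,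
    qJ0_mul_Jplus, qJ0_mul_Jminus, e1, e2, neg_neg, Matrix.add_kronecker, Matrix.kronecker_add,
    Matrix.smul_kronecker, Matrix.kronecker_smul]
  module

/-! ### Level decomposition -/

/-- The vector `x` is supported on the basis vectors with `i₁ + i₂ = T`, that is, it has weight
`T - j₁ - j₂`. -/
def HasLevel {a b : ℕ} (x : Fin (a + 1) × Fin (b + 1) → ℂ) (T : ℤ) : Prop :=
  ∀ p, x p ≠ 0 → ((p.1 : ℕ) : ℤ) + ((p.2 : ℕ) : ℤ) = T

section Level

variable {h : ℂ} {r : ℕ → ℂ} {a b : ℕ} {x : Fin (a + 1) × Fin (b + 1) → ℂ} {T : ℤ}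

theorem HasLevel.deltaJplus (hx : HasLevel x T) : HasLevel (deltaJplus h r a b *ᵥ x) (T + 1) := by
  rintro ⟨⟨k₁, hk₁⟩, ⟨k₂, hk₂⟩⟩ hp
  rw [deltaJplus_mulVec] at hp
  by_contra hT
  refine hp ?_
  simp only at hT ⊢
  have t1 : (Jplus r a *ᵥ fun j => x (j, ⟨k₂, hk₂⟩)) ⟨k₁, hk₁⟩ = 0 := by
    rcases k₁ with _ | n
    · exact Jplus_mulVec_zero r a _
    · rw [Jplus_mulVec_succ r (by omega)]
      have : x (⟨n, by omega⟩, ⟨k₂, hk₂⟩) = 0 := by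
        by_contra h0
        have := hx _ h0
        push_cast at *
        omega
      rw [this, mul_zero]
  have t2 : (Jplus r b *ᵥ fun j => x (⟨k₁, hk₁⟩, j)) ⟨k₂, hk₂⟩ = 0 := by
    rcases k₂ with _ | n
    · exact Jplus_mulVec_zero r b _
    · rw [Jplus_mulVec_succ r (by omega)]
      have : x (⟨k₁, hk₁⟩, ⟨n, by omega⟩) = 0 := by
        by_contra h0
        have := hx _ h0
        push_cast at *
        omega
      rw [this, mul_zero]
  rw [t1, t2]
  simp

theorem HasLevel.deltaJminus (hx : HasLevel x T) :
    HasLevel (deltaJminus h r a b *ᵥ x) (T - 1) := by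
  rintro ⟨⟨k₁, hk₁⟩, ⟨k₂, hk₂⟩⟩ hp
  rw [deltaJminus_mulVec] at hp
  by_contra hT
  refine hp ?_
  simp only at hT ⊢
  have t1 : (Jminus r a *ᵥ fun j => x (j, ⟨k₂, hk₂⟩)) ⟨k₁, hk₁⟩ = 0 := by
    rcases Nat.lt_succ_iff_lt_or_eq.1 hk₁ with hn | rfl
    · rw [Jminus_mulVec_of_lt r hn]
      have : x (⟨k₁ + 1, by omega⟩, ⟨k₂, hk₂⟩) = 0 := by
        by_contra h0
        have := hx _ h0
        push_cast at *
        omega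
      rw [this, mul_zero]
    · exact Jminus_mulVec_last r k₁ _
  have t2 : (Jminus r b *ᵥ fun j => x (⟨k₁, hk₁⟩, j)) ⟨k₂, hk₂⟩ = 0 := by
    rcases Nat.lt_succ_iff_lt_or_eq.1 hk₂ with hn | rfl
    · rw [Jminus_mulVec_of_lt r hn]
      have : x (⟨k₁, hk₁⟩, ⟨k₂ + 1, by omega⟩) = 0 := by
        by_contra h0
        have := hx _ h0
        push_cast at *
        omega
      rw [this, mul_zero]
    · exact Jminus_mulVec_last r k₂ _
  rw [t1, t2]
  simp

theorem HasLevel.deltaJplus_pow (hx : HasLevel x T) (n : ℕ) :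
    HasLevel (UqSU2.deltaJplus h r a b ^ n *ᵥ x) (T + n) := by
  induction n with
  | zero => simpa using hx
  | succ n ih =>
    rw [pow_succ', ← Matrix.mulVec_mulVec]
    have := ih.deltaJplus (h := h) (r := r)
    rwa [add_assoc, ← Nat.cast_succ] at this

theorem HasLevel.deltaJminus_pow (hx : HasLevel x T) (n : ℕ) :
    HasLevel (UqSU2.deltaJminus h r a b ^ n *ᵥ x) (T - n) := by
  induction n with
  | zero => simpa using hx
  | succ n ih =>
    rw [pow_succ', ← Matrix.mulVec_mulVec]
    have := ih.deltaJminus (h := h) (r := r)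
    rwa [sub_sub, ← Nat.cast_succ] at this

theorem HasLevel.eq_zero_of_lt (hx : HasLevel x T) (hT : (a : ℤ) + b < T) : x = 0 := by
  ext p
  by_contra hp
  have := hx p hp
  have := p.1.2
  have := p.2.2
  omega

theorem HasLevel.commutator (hx : HasLevel x T) (hr : ∀ k : ℕ, r k ^ 2 = qnum h k)
    (h1 : qnum h 1 = 1) :
    UqSU2.deltaJplus h r a b *ᵥ (UqSU2.deltaJminus h r a b *ᵥ x)
      = UqSU2.deltaJminus h r a b *ᵥ (UqSU2.deltaJplus h r a b *ᵥ x)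
        + qnum h (2 * T - a - b) • x := by
  rw [← sub_eq_iff_eq_add', Matrix.mulVec_mulVec, Matrix.mulVec_mulVec, ← Matrix.sub_mulVec,
    deltaJplus_mul_deltaJminus_sub hr h1]
  ext p
  rw [Matrix.mulVec_diagonal, Pi.smul_apply, smul_eq_mul]
  by_cases hp : x p = 0
  · simp [hp]
  · congr 2
    rw [← hx p hp]
    simp only [wt, spin]
    push_cast
    ring

/-- Iteration of the commutator along J₋: the numbers [2μ], [2μ-2], … picked up on the way, with μ
the weight of x, add up to a product of two q-numbers by `qnum_mul_sub_qnum_mul`. -/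
theorem HasLevel.commutator_pow (hx : HasLevel x T) (hr : ∀ k : ℕ, r k ^ 2 = qnum h k)
    (h1 : qnum h 1 = 1) (n : ℕ) :
    UqSU2.deltaJplus h r a b *ᵥ (UqSU2.deltaJminus h r a b ^ (n + 1) *ᵥ x)
      = UqSU2.deltaJminus h r a b ^ (n + 1) *ᵥ (UqSU2.deltaJplus h r a b *ᵥ x)
        + (qnum h (n + 1) * qnum h (2 * T - a - b - n))
          • (UqSU2.deltaJminus h r a b ^ n *ᵥ x) := by
  induction n with
  | zero => simpa [h1] using hx.commutator hr h1
  | succ n ih =>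
    rw [pow_succ' _ (n + 1), ← Matrix.mulVec_mulVec,
      (hx.deltaJminus_pow (n + 1)).commutator hr h1, ih, Matrix.mulVec_add, Matrix.mulVec_smul,
      Matrix.mulVec_mulVec _ _ (UqSU2.deltaJminus h r a b ^ (n + 1)),
      Matrix.mulVec_mulVec _ _ (UqSU2.deltaJminus h r a b ^ n),
      ← pow_succ', ← pow_succ', add_assoc, ← add_smul]
    congr 2
    have := qnum_mul_sub_qnum_mul h (n + 1) (2 * T - a - b - n - 1)
    rw [h1, mul_one] at this
    rw [show (2 * ((T - (n + 1 : ℕ) : ℤ) : ℚ) - a - b)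
        = -((n : ℚ) + 1 - (2 * T - a - b - n - 1)) by push_cast; ring, qnum_neg, ← this]
    push_cast
    rw [show (2 * (T : ℚ) - a - b - n - 1 + 1) = 2 * T - a - b - n by ring,
      show (2 * (T : ℚ) - a - b - (n + 1)) = 2 * T - a - b - n - 1 by ring]
    ring

/-- A highest weight vector whose coordinates at `|j₁ j₁⟩ |j₂ m₂⟩` vanish is zero. -/
theorem eq_zero_of_deltaJplus_eq_zero (hra : ∀ k, 1 ≤ k → k ≤ a → r k ≠ 0)
    (hx : UqSU2.deltaJplus h r a b *ᵥ x = 0) (hlast : ∀ k₂, x (Fin.last a, k₂) = 0) : x = 0 := by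
  have key : ∀ (n : ℕ) (hn : n < b + 1) (k₁ : Fin (a + 1)), x (k₁, ⟨n, hn⟩) = 0 := by
    intro n
    induction n with
    | zero =>
      rintro hn ⟨k₁, hk₁⟩
      rcases Nat.lt_succ_iff_lt_or_eq.1 hk₁ with hk | rfl
      · have := congrFun hx (⟨k₁ + 1, by omega⟩, 0)
        rw [deltaJplus_mulVec, Jplus_mulVec_zero, Jplus_mulVec_succ r hk] at this
        have n1 := hra (a - k₁) (by omega) (by omega)
        have n2 := hra (k₁ + 1) (by omega) (by omega)
        simpa [qpow_ne_zero, n1, n2] using this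
      · exact hlast _
    | succ n ih =>
      rintro hn ⟨k₁, hk₁⟩
      rcases Nat.lt_succ_iff_lt_or_eq.1 hk₁ with hk | rfl
      -- This row of J₊ x = 0 involves only x(k₁, n+1), with a nonzero coefficient, and x(k₁+1, n),
      -- already known to vanish.
      · have := congrFun hx (⟨k₁ + 1, by omega⟩, ⟨n + 1, hn⟩)
        rw [deltaJplus_mulVec, Jplus_mulVec_succ r hk, Jplus_mulVec_succ r (by omega),
          ih (by omega)] at this
        have n1 := hra (a - k₁) (by omega) (by omega)
        have n2 := hra (k₁ + 1) (by omega) (by omega)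
        simpa [qpow_ne_zero, n1, n2] using this
      · exact hlast _
  ext p
  exact key p.2 p.2.2 p.1

end Level

/-! ### Canonical bases inside the tensor product -/

/-- M is the offset between indices and weights: m₁ + m₂ = m₃ reads i₁ + i₂ = i₃ + M. -/
theorem wt_add_wt (M A B : ℕ) (p : Fin (M + B + 1) × Fin (M + A + 1)) (i : Fin (A + B + 1)) :
    wt (M + B) p.1 + wt (M + A) p.2 - wt (A + B) i
      = (((p.1 : ℕ) : ℚ) + ((p.2 : ℕ) : ℚ)) - (((i : ℕ) : ℚ) + M) := by
  simp only [wt, spin]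
  push_cast
  ring

theorem refIdx_eq (M A B : ℕ) :
    refIdx (M + B) (M + A) (A + B) = (Fin.last (M + B), ⟨A, by omega⟩) := by
  simp only [refIdx, Prod.mk.injEq, true_and]
  ext
  simp only [Fin.ofNat]
  rw [show (M + A + (A + B) - (M + B)) / 2 = A by omega, Nat.mod_eq_of_lt (by omega)]

theorem ladderCoeff_eq (r : ℕ → ℂ) (c : ℕ) (i : Fin (c + 1)) :
    ladderCoeff r c i = natSqFact r i / (natSqFact r c * natSqFact r (c - i)) := by
  have hi := i.2
  rw [ladderCoeff, sqfact_eq r (n := i), sqfact_eq r (n := c), sqfact_eq r (n := c - i)]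
  · rw [Nat.cast_sub (by omega)]
    simp only [wt, spin]
    ring
  · simp only [spin]
    ring
  · simp only [wt, spin]
    ring

/-! ### Ladder relations and norms in an abstract canonical basis -/

section Canonical

variable {h : ℂ} {r : ℕ → ℂ} {c : ℕ} {ι : Type} [Fintype ι] {K E F : Matrix ι ι ℂ}
  {v : Fin (c + 1) → ι → ℂ}

theorem IsCanonicalBasis.lower_succ (hv : IsCanonicalBasis h r c K E F v) {n : ℕ} (hn : n < c) :
    F *ᵥ v ⟨n + 1, by omega⟩ = (r (n + 1) * r (c - n)) • v ⟨n, by omega⟩ := by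
  rw [hv.lower]
  simp only
  rw [sum_ite_val_add_one_eq hn fun k => (r (n + 1) * r (c - (n + 1) + 1)) • v k,
    show c - (n + 1) + 1 = c - n by omega]

theorem IsCanonicalBasis.raise_of_lt (hv : IsCanonicalBasis h r c K E F v) {n : ℕ} (hn : n < c) :
    E *ᵥ v ⟨n, by omega⟩ = (r (c - n) * r (n + 1)) • v ⟨n + 1, by omega⟩ := by
  rw [hv.raise]
  exact sum_ite_val_eq_add_one hn fun k => (r (c - n) * r (n + 1)) • v k

theorem IsCanonicalBasis.raise_last (hv : IsCanonicalBasis h r c K E F v) :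
    E *ᵥ v (Fin.last c) = 0 := by
  rw [hv.raise]
  refine Finset.sum_eq_zero fun k _ => if_neg ?_
  have := k.2
  simp only [Fin.val_last]
  omega

/-- The ladder coefficient is the inverse of the product of the J₋-coefficients met on the way down,
so the top vector determines the whole basis. -/
theorem IsCanonicalBasis.lowering_mulVec_last [DecidableEq ι]
    (hv : IsCanonicalBasis h r c K E F v) (hr0 : ∀ k, 1 ≤ k → k ≤ c → r k ≠ 0)
    (i : Fin (c + 1)) : lowering r c i F *ᵥ v (Fin.last c) = v i := by
  have key : ∀ n (hn : n ≤ c), natSqFact r (c - n) • (F ^ n *ᵥ v (Fin.last c))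
      = (natSqFact r c * natSqFact r n) • v ⟨c - n, by omega⟩ := by
    intro n
    induction n with
    | zero => simp [Fin.last]
    | succ n ih =>
      intro hn
      have e : (⟨c - n, by omega⟩ : Fin (c + 1)) = ⟨c - (n + 1) + 1, by omega⟩ := by
        ext
        simp only
        omega
      have hne := hr0 (c - n) (by omega) (by omega)
      have ih' := congrArg (F *ᵥ ·) (ih (by omega))
      simp only [Matrix.mulVec_smul, Matrix.mulVec_mulVec] at ih'
      rw [← pow_succ', e, hv.lower_succ (by omega), show c - n = c - (n + 1) + 1 by omega,
        natSqFact_succ, show c - (c - (n + 1)) = n + 1 by omega] at ih'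
      rw [show c - n = c - (n + 1) + 1 by omega] at hne
      rw [natSqFact_succ r n]
      refine smul_right_injective _ hne ?_
      simp only
      rw [smul_smul, mul_comm, ih', smul_smul, smul_smul]
      congr 1
      ring
  have hi : (i : ℕ) ≤ c := by
    have := i.2
    omega
  have e : (⟨c - (c - (i : ℕ)), by omega⟩ : Fin (c + 1)) = i := by
    ext
    simp only
    omega
  have := key (c - i) (by omega)
  rw [e, show c - (c - (i : ℕ)) = i by omega] at this
  have n1 := natSqFact_ne_zero hr0 le_rfl
  have n2 := natSqFact_ne_zero (n := c - i) hr0 (by omega)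
  rw [lowering, Matrix.smul_mulVec, ladderCoeff_eq, div_eq_inv_mul, mul_smul, this, smul_smul,
    inv_mul_cancel₀ (mul_ne_zero n1 n2), one_smul]

/-- In (F v_{k+1}) · v_k = v_{k+1} · (E v_k) both sides carry the same nonzero coefficient, so
neighbouring norms agree. -/
theorem IsCanonicalBasis.dotProduct_self (hEF : Eᵀ = F) (hv : IsCanonicalBasis h r c K E F v)
    (hr0 : ∀ k, 1 ≤ k → k ≤ c → r k ≠ 0) (h1 : v (Fin.last c) ⬝ᵥ v (Fin.last c) = 1)
    (i : Fin (c + 1)) : v i ⬝ᵥ v i = 1 := by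
  have key : ∀ n (hn : n ≤ c), v ⟨c - n, by omega⟩ ⬝ᵥ v ⟨c - n, by omega⟩ = 1 := by
    intro n
    induction n with
    | zero => exact fun _ => h1
    | succ n ih =>
      intro hn
      have e : (⟨c - n, by omega⟩ : Fin (c + 1)) = ⟨c - (n + 1) + 1, by omega⟩ := by
        ext
        simp only
        omega
      have ih' := ih (by omega)
      rw [e] at ih'
      have hs : (F *ᵥ v ⟨c - (n + 1) + 1, by omega⟩) ⬝ᵥ v ⟨c - (n + 1), by omega⟩
          = v ⟨c - (n + 1) + 1, by omega⟩ ⬝ᵥ (E *ᵥ v ⟨c - (n + 1), by omega⟩) := by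
        rw [Matrix.dotProduct_mulVec, ← hEF, Matrix.mulVec_transpose]
      rw [hv.lower_succ (by omega), hv.raise_of_lt (by omega), smul_dotProduct, dotProduct_smul,
        ih', show c - (c - (n + 1)) = n + 1 by omega, smul_eq_mul, smul_eq_mul,
        mul_comm (r (n + 1))] at hs
      have n1 := hr0 (n + 1) (by omega) (by omega)
      have n2 := hr0 (c - (n + 1) + 1) (by omega) (by omega)
      exact mul_left_cancel₀ (mul_ne_zero n2 n1) hs
  have hi : (i : ℕ) ≤ c := by
    have := i.2
    omega
  have := key (c - i) (by omega)
  have e : (⟨c - (c - (i : ℕ)), by omega⟩ : Fin (c + 1)) = i := by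
    ext
    simp only
    omega
  rwa [e] at this

end Canonical

/-! ### Uniqueness and construction of canonical bases in j₁ ⊗ j₂ -/

section Tensor

variable {h : ℂ} {r : ℕ → ℂ} {M A B : ℕ}

theorem ne_zero_of_sq_eq_qnum {N : ℕ} (hr : ∀ k : ℕ, r k ^ 2 = qnum h k)
    (hq : ∀ k : ℕ, 1 ≤ k → k ≤ N → qnum h k ≠ 0) (k : ℕ) (h1 : 1 ≤ k) (h2 : k ≤ N) :
    r k ≠ 0 := by
  intro h0
  apply hq k h1 h2
  rw [← hr, h0]
  simp

theorem qnum_one_of_ne_zero {N : ℕ} (hq : ∀ k : ℕ, 1 ≤ k → k ≤ N + 1 → qnum h k ≠ 0) :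
    qnum h 1 = 1 :=
  qnum_one (sub_ne_zero_of_qnum_ne_zero (hq 1 le_rfl (by omega)))

/-- The eigenvalue of q^(J₀) fixes the weight only up to d with q^d = 1, hence [d] = 0. Here |d| ≤
M+A+B, so the nonvanishing assumption forces d = 0, even when q is a root of unity. -/
theorem IsCanonicalBasis.hasLevel {E F} {v : Fin (A + B + 1) → _}
    (hv : IsCanonicalBasis h r (A + B) (deltaQJ0 h (M + B) (M + A)) E F v)
    (hq : ∀ k : ℕ, 1 ≤ k → k ≤ M + A + B + 1 → qnum h k ≠ 0) (i : Fin (A + B + 1)) :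
    HasLevel (v i) ((i : ℕ) + M) := by
  intro p hp
  have hw := congrFun (hv.weight i) p
  rw [deltaQJ0_mulVec, Pi.smul_apply, smul_eq_mul] at hw
  have hw := mul_right_cancel₀ hp hw
  by_contra hne
  set d : ℤ := ((p.1 : ℕ) : ℤ) + ((p.2 : ℕ) : ℤ) - ((i : ℕ) + M) with hd
  have e1 : qpow h (d : ℚ) = 1 := by
    have : (d : ℚ) = (wt (M + B) p.1 + wt (M + A) p.2) + -wt (A + B) i := by
      rw [← sub_eq_add_neg, wt_add_wt, hd]
      push_cast
      ring
    rw [this, qpow_add, hw, qpow_mul_qpow_neg]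
  have e2 := qnum_eq_zero_of_qpow_eq_one e1
  have h1 := p.1.2
  have h2 := p.2.2
  have h3 := i.2
  have hne' : d ≠ 0 := by omega
  refine hq d.natAbs (by omega) (by omega) ?_
  rw [Nat.cast_natAbs]
  rcases abs_choice d with h' | h'
  · rwa [h']
  · rw [h', Int.cast_neg, qnum_neg, e2, neg_zero]

theorem HasLevel.sub {a b : ℕ} {x y : Fin (a + 1) × Fin (b + 1) → ℂ} {T : ℤ} (hx : HasLevel x T)
    (hy : HasLevel y T) : HasLevel (x - y) T := by
  intro p hp
  by_cases h0 : x p = 0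
  · exact hy p fun h1 => hp (by simp [h0, h1])
  · exact hx p h0

theorem HasLevel.smul {a b : ℕ} {x : Fin (a + 1) × Fin (b + 1) → ℂ} {T : ℤ} (hx : HasLevel x T)
    (z : ℂ) : HasLevel (z • x) T := fun p hp =>
  hx p fun h0 => hp (by simp [h0])

/-- A highest weight vector of weight `j₃` is determined by its coordinate at
`|j₁ j₁⟩ |j₂ j₃ - j₁⟩`. -/
theorem HasLevel.eq_zero_of_highest {x : Fin (M + B + 1) × Fin (M + A + 1) → ℂ}
    (hx : HasLevel x (M + A + B)) (hr0 : ∀ k, 1 ≤ k → k ≤ M + A + B + 1 → r k ≠ 0)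
    (hE : UqSU2.deltaJplus h r (M + B) (M + A) *ᵥ x = 0)
    (href : x (refIdx (M + B) (M + A) (A + B)) = 0) : x = 0 := by
  refine eq_zero_of_deltaJplus_eq_zero (fun k h1 h2 => hr0 k h1 (by omega)) hE ?_
  rintro ⟨k, hk⟩
  by_contra h0
  have hl := hx _ h0
  simp only [Fin.val_last] at hl
  obtain rfl : k = A := by omega
  rw [refIdx_eq] at href
  exact h0 href

theorem HasLevel.eq_smul_of_highest {x y : Fin (M + B + 1) × Fin (M + A + 1) → ℂ}
    (hx : HasLevel x (M + A + B)) (hy : HasLevel y (M + A + B))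
    (hr0 : ∀ k, 1 ≤ k → k ≤ M + A + B + 1 → r k ≠ 0)
    (hEx : UqSU2.deltaJplus h r (M + B) (M + A) *ᵥ x = 0)
    (hEy : UqSU2.deltaJplus h r (M + B) (M + A) *ᵥ y = 0)
    (href : y (refIdx (M + B) (M + A) (A + B)) ≠ 0) :
    x = (x (refIdx (M + B) (M + A) (A + B)) / y (refIdx (M + B) (M + A) (A + B))) • y := by
  rw [← sub_eq_zero]
  refine (hx.sub (hy.smul _)).eq_zero_of_highest (h := h) hr0 ?_ ?_
  · rw [Matrix.mulVec_sub, Matrix.mulVec_smul, hEx, hEy, smul_zero, sub_zero]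
  · simp [href]

theorem IsCanonicalBasis.hasLevel_last {E F} {v : Fin (A + B + 1) → _}
    (hv : IsCanonicalBasis h r (A + B) (deltaQJ0 h (M + B) (M + A)) E F v)
    (hq : ∀ k : ℕ, 1 ≤ k → k ≤ M + A + B + 1 → qnum h k ≠ 0) :
    HasLevel (v (Fin.last _)) (M + A + B) := by
  have := hv.hasLevel hq (Fin.last _)
  rw [Fin.val_last] at this
  convert this using 1
  push_cast
  ring

/-- Two canonical bases of spin `j₃` in `j₁ ⊗ j₂` are proportional. -/
theorem IsCanonicalBasis.eq_smul {v w : Fin (A + B + 1) → _}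
    (hv : IsCanonicalBasis h r (A + B) (deltaQJ0 h (M + B) (M + A))
      (UqSU2.deltaJplus h r (M + B) (M + A)) (UqSU2.deltaJminus h r (M + B) (M + A)) v)
    (hw : IsCanonicalBasis h r (A + B) (deltaQJ0 h (M + B) (M + A))
      (UqSU2.deltaJplus h r (M + B) (M + A)) (UqSU2.deltaJminus h r (M + B) (M + A)) w)
    (hr : ∀ k : ℕ, r k ^ 2 = qnum h k)
    (hq : ∀ k : ℕ, 1 ≤ k → k ≤ M + A + B + 1 → qnum h k ≠ 0)
    (href : w (Fin.last _) (refIdx (M + B) (M + A) (A + B)) ≠ 0) (i : Fin (A + B + 1)) :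
    v i = (v (Fin.last _) (refIdx (M + B) (M + A) (A + B))
      / w (Fin.last _) (refIdx (M + B) (M + A) (A + B))) • w i := by
  have hr0 := ne_zero_of_sq_eq_qnum hr hq
  have hr1 : ∀ k, 1 ≤ k → k ≤ A + B → r k ≠ 0 := fun k h1 h2 => hr0 k h1 (by omega)
  rw [← hv.lowering_mulVec_last hr1 i, ← hw.lowering_mulVec_last hr1 i, ← Matrix.mulVec_smul]
  congr 1
  exact (hv.hasLevel_last hq).eq_smul_of_highest (hw.hasLevel_last hq) hr0 hv.raise_last
    hw.raise_last href

/-- A ladder of vectors generated by `J₋` from a highest weight vector of weight `j₃` is a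
canonical basis. -/
theorem isCanonicalBasis_of_lower (hr : ∀ k : ℕ, r k ^ 2 = qnum h k)
    (hq : ∀ k : ℕ, 1 ≤ k → k ≤ M + A + B + 1 → qnum h k ≠ 0)
    {u : ℕ → Fin (M + B + 1) × Fin (M + A + 1) → ℂ}
    (hlev : ∀ n, n ≤ A + B → HasLevel (u n) (n + M))
    (hlow : ∀ n, n < A + B → UqSU2.deltaJminus h r (M + B) (M + A) *ᵥ u (n + 1)
      = (r (n + 1) * r (A + B - n)) • u n)
    (htop : UqSU2.deltaJplus h r (M + B) (M + A) *ᵥ u (A + B) = 0) :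
    IsCanonicalBasis h r (A + B) (deltaQJ0 h (M + B) (M + A))
      (UqSU2.deltaJplus h r (M + B) (M + A)) (UqSU2.deltaJminus h r (M + B) (M + A))
      fun i => u i := by
  have h1 : qnum h 1 = 1 := qnum_one_of_ne_zero hq
  have hr0 := ne_zero_of_sq_eq_qnum hr hq
  have hrz := sqrt_zero hr
  -- The J₊-relation is obtained by induction downwards from the top, d being the distance to it:
  -- apply J₊J₋ = J₋J₊ + [2J₀] to u (n+1) and divide by the J₋-coefficient.
  have hup : ∀ d n, n + d = A + B → UqSU2.deltaJplus h r (M + B) (M + A) *ᵥ u n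
      = (r (A + B - n) * r (n + 1)) • u (n + 1) := by
    intro d
    induction d with
    | zero =>
      rintro n rfl
      simpa [hrz] using htop
    | succ d ih =>
      intro n hn
      have hc := (hlev (n + 1) (by omega)).commutator hr h1
      -- At the top, u (n+1+1) lies beyond the ladder and is unconstrained, but its coefficient
      -- contains r 0 = 0.
      have hF : (r (A + B - (n + 1)) * r (n + 1 + 1)) •
          (UqSU2.deltaJminus h r (M + B) (M + A) *ᵥ u (n + 1 + 1))
          = (r (A + B - (n + 1)) ^ 2 * r (n + 1 + 1) ^ 2) • u (n + 1) := by
        rcases Nat.eq_zero_or_pos d with rfl | hd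
        · rw [show A + B - (n + 1) = 0 by omega, hrz]
          simp
        · rw [hlow _ (by omega), smul_smul]
          congr 1
          ring
      rw [ih (n + 1) (by omega), hlow n (by omega), Matrix.mulVec_smul, Matrix.mulVec_smul, hF,
        ← add_smul] at hc
      have n1 := hr0 (n + 1) (by omega) (by omega)
      have n2 := hr0 (A + B - n) (by omega) (by omega)
      refine smul_right_injective _ (mul_ne_zero n1 n2) (hc.trans ?_)
      simp only
      rw [smul_smul, show r (n + 1) * r (A + B - n) * (r (A + B - n) * r (n + 1))
        = r (n + 1) ^ 2 * r (A + B - n) ^ 2 by ring, hr, hr, hr, hr]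
      congr 1
      have := qnum_mul_sub_qnum_mul h (n + 1) ((d : ℚ))
      rw [h1, mul_one] at this
      rw [show A + B - (n + 1) = d by omega, show A + B - n = d + 1 by omega]
      have hn' : (n : ℚ) + (d + 1) = A + B := by exact_mod_cast hn
      have e : (2 * ((((n + 1 : ℕ) : ℤ) + (M : ℤ) : ℤ) : ℚ) - ((M + B : ℕ) : ℚ)
          - ((M + A : ℕ) : ℚ)) = (n + 1) - d := by
        push_cast
        linarith
      rw [e, ← this]
      push_cast
      ring
  -- J₋ u₀ is killed by J₊, and its level M-1 is too low for a coordinate with first index M+B; such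
  -- a highest weight vector is zero.
  have hbot : UqSU2.deltaJminus h r (M + B) (M + A) *ᵥ u 0 = 0 := by
    refine eq_zero_of_deltaJplus_eq_zero (h := h) (r := r)
      (fun k h1 h2 => hr0 k h1 (by omega)) ?_ ?_
    · rw [(hlev 0 (by omega)).commutator hr h1, hup (A + B) 0 (by omega), Matrix.mulVec_smul]
      have e : (2 * ((((0 : ℕ) : ℤ) + (M : ℤ) : ℤ) : ℚ) - ((M + B : ℕ) : ℚ)
          - ((M + A : ℕ) : ℚ)) = -((A + B : ℕ) : ℚ) := by
        push_cast
        ring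
      rw [e, qnum_neg]
      rcases Nat.eq_zero_or_pos (A + B) with h0 | hpos
      · rw [h0, hrz]
        simp [qnum_zero]
      · rw [hlow 0 hpos, smul_smul, ← add_smul,
          show r (A + B - 0) * r (0 + 1) * (r (0 + 1) * r (A + B - 0))
            = r (A + B) ^ 2 * r 1 ^ 2 by simp; ring, hr, hr, Nat.cast_one, h1]
        simp
    · intro k
      by_contra h0
      have := (hlev 0 (by omega)).deltaJminus (h := h) (r := r) _ h0
      simp only [Fin.val_last] at this
      push_cast at this
      omega
  refine ⟨fun i => ?_, fun i => ?_, fun i => ?_⟩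
  · ext p
    rw [deltaQJ0_mulVec, Pi.smul_apply, smul_eq_mul]
    by_cases hp : u i p = 0
    · simp [hp]
    · congr 2
      have hl := hlev i (by have := i.2; omega) p hp
      have hl' : ((p.1 : ℕ) : ℚ) + ((p.2 : ℕ) : ℚ) = (i : ℕ) + M := by exact_mod_cast hl
      have := wt_add_wt M A B p i
      linarith
  · rcases i with ⟨n, hn⟩
    rw [hup (A + B - n) n (by omega)]
    rcases Nat.lt_succ_iff_lt_or_eq.1 hn with hn' | rfl
    · rw [sum_ite_val_eq_add_one hn' fun k : Fin (A + B + 1) =>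
        (r (A + B - n) * r (n + 1)) • u k]
    · rw [Nat.sub_self, hrz]
      simp
  · rcases i with ⟨n, hn⟩
    rcases n with _ | n
    · exact hbot.trans (by simp)
    · rw [hlow n (by omega)]
      rw [sum_ite_val_add_one_eq (by omega) fun k : Fin (A + B + 1) =>
        (r (n + 1) * r (A + B - (n + 1) + 1)) • u k, show A + B - (n + 1) + 1 = A + B - n by omega]

/-- Vectors of different index have different levels, hence disjoint supports; only the norms need
an argument, and they follow from the top one. -/
theorem IsCanonicalBasis.isCoupledBasis {v : Fin (A + B + 1) → _}
    (hv : IsCanonicalBasis h r (A + B) (deltaQJ0 h (M + B) (M + A))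
      (UqSU2.deltaJplus h r (M + B) (M + A)) (UqSU2.deltaJminus h r (M + B) (M + A)) v)
    (hr : ∀ k : ℕ, r k ^ 2 = qnum h k)
    (hq : ∀ k : ℕ, 1 ≤ k → k ≤ M + A + B + 1 → qnum h k ≠ 0)
    (hnorm : v (Fin.last _) ⬝ᵥ v (Fin.last _) = 1) :
    IsCoupledBasis h r (M + B) (M + A) (A + B) v := by
  have hr0 := ne_zero_of_sq_eq_qnum hr hq
  refine ⟨hv, fun i k => ?_⟩
  split_ifs with hik
  · subst hik
    exact hv.dotProduct_self (deltaJplus_transpose _ _ _ _) (fun k h1 h2 => hr0 k h1 (by omega))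
      hnorm i
  · refine Finset.sum_eq_zero fun p _ => ?_
    by_contra h0
    have l1 := hv.hasLevel hq i p (left_ne_zero_of_mul h0)
    have l2 := hv.hasLevel hq k p (right_ne_zero_of_mul h0)
    refine hik (Fin.ext ?_)
    omega

/-! ### The extremal projector -/

/-- `J₊ p = 0` on vectors of weight `j₃`. -/
theorem HasLevel.deltaJplus_extremalProj {x : Fin (M + B + 1) × Fin (M + A + 1) → ℂ}
    (hx : HasLevel x (M + A + B)) (hr : ∀ k : ℕ, r k ^ 2 = qnum h k)
    (hq : ∀ k : ℕ, 1 ≤ k → k ≤ M + A + B + 1 → qnum h k ≠ 0) :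
    UqSU2.deltaJplus h r (M + B) (M + A) *ᵥ (extremalProj h (spin (A + B))
      (UqSU2.deltaJplus h r (M + B) (M + A)) (UqSU2.deltaJminus h r (M + B) (M + A)) *ᵥ x)
      = 0 := by
  have h1 : qnum h 1 = 1 := qnum_one_of_ne_zero hq
  set E := UqSU2.deltaJplus h r (M + B) (M + A) with hE
  set F := UqSU2.deltaJminus h r (M + B) (M + A) with hF
  set κ : ℕ → ℂ := fun n => (-1) ^ n / (qfact h n *
    ∏ k ∈ Finset.range n, qnum h (2 * spin (A + B) + 2 + k)) with hκ
  have hvan : ∀ n, M < n → E ^ n *ᵥ x = 0 := fun n hn =>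
    (hx.deltaJplus_pow n).eq_zero_of_lt (by push_cast; omega)
  -- The bound n+1 ≤ M is what makes the two q-numbers nonzero; for larger n the vector E^(n+1) x
  -- vanishes instead.
  have hrec : ∀ n, n + 1 ≤ M →
      κ (n + 1) * (qnum h (n + 1) * qnum h (A + B + n + 2)) = -κ n := by
    intro n hn
    have n1 : qnum h ((n : ℚ) + 1) ≠ 0 := by simpa using hq (n + 1) (by omega) (by omega)
    have n2 : qnum h ((A : ℚ) + B + n + 2) ≠ 0 := by
      simpa using hq (A + B + n + 2) (by omega) (by omega)
    have e : 2 * spin (A + B) + 2 + (n : ℚ) = A + B + n + 2 := by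
      simp only [spin]
      push_cast
      ring
    simp only [hκ]
    rw [qfact_eq h rfl, qfact_eq h rfl, natQFact_succ, Finset.prod_range_succ, e, pow_succ]
    rw [show (-1 : ℂ) ^ n * -1 / (natQFact h n * qnum h (n + 1) *
          ((∏ k ∈ Finset.range n, qnum h (2 * spin (A + B) + 2 + k)) * qnum h (A + B + n + 2)))
        = -((-1) ^ n / (natQFact h n *
          ∏ k ∈ Finset.range n, qnum h (2 * spin (A + B) + 2 + k)))
          / (qnum h (n + 1) * qnum h (A + B + n + 2)) by
      rw [← neg_div, div_div]
      congr 1 <;> ring]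
    exact div_mul_cancel₀ _ (mul_ne_zero n1 n2)
  -- The partial sums telescope: commuting E past F^(n+1) creates exactly the term that cancels the
  -- previous remainder. The final remainder contains a power of E above M, which kills x.
  have key : ∀ n, E *ᵥ ((∑ k ∈ Finset.range (n + 1), κ k • (F ^ k * E ^ k)) *ᵥ x)
      = κ n • (F ^ n *ᵥ (E ^ (n + 1) *ᵥ x)) := by
    intro n
    induction n with
    | zero => simp [hκ, qfact]
    | succ n ih =>
      rw [Finset.sum_range_succ, Matrix.add_mulVec, Matrix.mulVec_add, ih, Matrix.smul_mulVec,
        Matrix.mulVec_smul, ← Matrix.mulVec_mulVec,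
        (hx.deltaJplus_pow (n + 1)).commutator_pow hr h1 n, ← hE, ← hF, smul_add,
        Matrix.mulVec_mulVec _ E, ← pow_succ', add_left_comm]
      rw [add_eq_left]
      rcases Nat.lt_or_ge M (n + 1) with hn | hn
      · rw [hvan _ hn]
        simp
      · have e : (2 * (((M : ℤ) + A + B + (n + 1 : ℕ) : ℤ) : ℚ) - ((M + B : ℕ) : ℚ)
            - ((M + A : ℕ) : ℚ) - n) = A + B + n + 2 := by
          push_cast
          ring
        rw [e, smul_smul, hrec n hn, ← add_smul]
        simp
  have hcard : Fintype.card (Fin (M + B + 1) × Fin (M + A + 1))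
      = (M + B + 1) * (M + A + 1) - 1 + 1 := by
    rw [Fintype.card_prod, Fintype.card_fin, Fintype.card_fin]
    exact (Nat.succ_pred_eq_of_pos (Nat.mul_pos (Nat.succ_pos _) (Nat.succ_pos _))).symm
  rw [extremalProj, hcard, key, hvan, Matrix.mulVec_zero, smul_zero]
  have : M + B + 1 ≤ (M + B + 1) * (M + A + 1) := Nat.le_mul_of_pos_right _ (Nat.succ_pos _)
  omega

theorem HasLevel.extremalProj {x : Fin (M + B + 1) × Fin (M + A + 1) → ℂ} {T : ℤ}
    (hx : HasLevel x T) (μ : ℚ) :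
    HasLevel (UqSU2.extremalProj h μ (UqSU2.deltaJplus h r (M + B) (M + A))
      (UqSU2.deltaJminus h r (M + B) (M + A)) *ᵥ x) T := by
  intro p hp
  rw [UqSU2.extremalProj, Matrix.sum_mulVec, Finset.sum_apply] at hp
  obtain ⟨n, _, hn⟩ := Finset.exists_ne_zero_of_sum_ne_zero hp
  rw [Matrix.smul_mulVec, ← Matrix.mulVec_mulVec] at hn
  have := ((hx.deltaJplus_pow (h := h) (r := r) n).deltaJminus_pow (h := h) (r := r) n).smul _ p hn
  omega

/-- Every term with n ≥ 1 begins with J₋, which transposes to J₊ acting on y. -/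
theorem dotProduct_extremalProj_mulVec {y : Fin (M + B + 1) × Fin (M + A + 1) → ℂ}
    (hy : UqSU2.deltaJplus h r (M + B) (M + A) *ᵥ y = 0) (μ : ℚ)
    (x : Fin (M + B + 1) × Fin (M + A + 1) → ℂ) :
    y ⬝ᵥ (extremalProj h μ (UqSU2.deltaJplus h r (M + B) (M + A))
      (UqSU2.deltaJminus h r (M + B) (M + A)) *ᵥ x) = y ⬝ᵥ x := by
  rw [extremalProj, Matrix.sum_mulVec, dotProduct_sum, Finset.sum_eq_single 0]
  · simp [qfact]
  · intro n _ hn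
    obtain ⟨n, rfl⟩ := Nat.exists_eq_succ_of_ne_zero hn
    rw [Matrix.smul_mulVec, dotProduct_smul, Nat.succ_eq_add_one,
      pow_succ' (UqSU2.deltaJminus h r (M + B) (M + A)) n, mul_assoc,
      ← Matrix.mulVec_mulVec, Matrix.dotProduct_mulVec, ← Matrix.mulVec_transpose,
      deltaJminus_transpose, hy, zero_dotProduct, smul_zero]
  · intro h0
    exact absurd (Finset.mem_range.2 Fintype.card_pos) h0

theorem genProj_last {ι : Type} [Fintype ι] [DecidableEq ι] {c : ℕ}
    (hr0 : ∀ k, 1 ≤ k → k ≤ c → r k ≠ 0) (i : Fin (c + 1)) (E F : Matrix ι ι ℂ) :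
    genProj h r c i (Fin.last c) E F = lowering r c i F * extremalProj h (spin c) E F := by
  have := natSqFact_ne_zero hr0 le_rfl
  simp [genProj, rising, ladderCoeff_eq, this]

/-- Otherwise the top vector would be zero, contradicting its norm 1. -/
theorem IsCoupledBasis.apply_refIdx_ne_zero {v : Fin (A + B + 1) → _}
    (hv : IsCoupledBasis h r (M + B) (M + A) (A + B) v)
    (hr : ∀ k : ℕ, r k ^ 2 = qnum h k)
    (hq : ∀ k : ℕ, 1 ≤ k → k ≤ M + A + B + 1 → qnum h k ≠ 0) :
    v (Fin.last _) (refIdx (M + B) (M + A) (A + B)) ≠ 0 := by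
  intro h0
  have hz := (hv.canonical.hasLevel_last hq).eq_zero_of_highest (ne_zero_of_sq_eq_qnum hr hq)
    hv.canonical.raise_last h0
  have := hv.orthonormal (Fin.last _) (Fin.last _)
  simp [hz] at this

/-- The matrix elements of the general projection operator are products of Clebsch–Gordan
coefficients. -/
theorem IsCoupledBasis.projElem_eq {v : Fin (A + B + 1) → _}
    (hv : IsCoupledBasis h r (M + B) (M + A) (A + B) v)
    (hr : ∀ k : ℕ, r k ^ 2 = qnum h k)
    (hq : ∀ k : ℕ, 1 ≤ k → k ≤ M + A + B + 1 → qnum h k ≠ 0)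
    (i₁ : Fin (M + B + 1)) (i₂ : Fin (M + A + 1)) (i₃ : Fin (A + B + 1)) :
    projElem h r (M + B) (M + A) (A + B) i₁ i₂ i₃
      = v i₃ (i₁, i₂) * v (Fin.last _) (refIdx (M + B) (M + A) (A + B)) := by
  have hr0 := ne_zero_of_sq_eq_qnum hr hq
  have hr1 : ∀ k, 1 ≤ k → k ≤ A + B → r k ≠ 0 := fun k h1 h2 => hr0 k h1 (by omega)
  have href := hv.apply_refIdx_ne_zero hr hq
  set ρ := refIdx (M + B) (M + A) (A + B) with hρ
  set e : Fin (M + B + 1) × Fin (M + A + 1) → ℂ := Pi.single ρ 1 with he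
  have hlev : HasLevel e (M + A + B) := by
    intro p hp
    have : p = ρ := by
      by_contra h0
      exact hp (by simp [he, h0])
    rw [this, hρ, refIdx_eq]
    simp only [Fin.val_last]
    push_cast
    ring
  -- p e is a highest weight vector, hence a multiple of the top vector; pairing with the top
  -- vector, in `hdot`, identifies the factor as its reference coordinate.
  have hproj := (hlev.extremalProj (h := h) (r := r) (spin (A + B))).eq_smul_of_highest
    (hv.canonical.hasLevel_last hq) hr0 (hlev.deltaJplus_extremalProj hr hq)
    hv.canonical.raise_last href
  have hdot := dotProduct_extremalProj_mulVec hv.canonical.raise_last (spin (A + B)) e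
  have horth := hv.orthonormal (Fin.last _) (Fin.last _)
  rw [if_pos rfl] at horth
  rw [hproj, dotProduct_smul, horth, smul_eq_mul, mul_one] at hdot
  rw [hdot, he, dotProduct_single, mul_one] at hproj
  have hcol : ∀ X : Matrix (Fin (M + B + 1) × Fin (M + A + 1)) _ ℂ,
      X (i₁, i₂) ρ = (X *ᵥ e) (i₁, i₂) := by
    intro X
    simp [he]
  rw [projElem, genProj_last hr1, ← hρ]
  refine (hcol _).trans ?_
  rw [← Matrix.mulVec_mulVec, he, hproj,
    Matrix.mulVec_smul, hv.canonical.lowering_mulVec_last hr1, Pi.smul_apply, smul_eq_mul,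
    mul_comm]

end Tensor

/-! ### The explicit Clebsch–Gordan coefficients

The spins are `j₁ = (M + B) / 2`, `j₂ = (M + A) / 2`, `j₃ = (A + B) / 2`. -/

/-- The sum over `n` in the explicit formula, multiplied by `[x]!` where `x = j₂ - m₂`. -/
noncomputable def cgInner (h : ℂ) (M A B k₁ : ℕ) (x : ℚ) (i : ℕ) : ℂ :=
  ∑ n ∈ Finset.range (M + 1), (-1) ^ (M - n) * qpow h (n * k₁) * natQFact h (M + A - n)
    * natQFact h (M + A + B - i - n)
    / (natQFact h n * natQFact h (M - n) * natQFact h (M + A + B + 1 - n)) * qDescFact h x n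

/-- The constant `√([2j₃+1][j₁+j₂-j₃]![j₁-j₂+j₃]![j₁+j₂+j₃+1]! / [-j₁+j₂+j₃]!)`. -/
noncomputable def cgConst (r : ℕ → ℂ) (M A B : ℕ) : ℂ :=
  r (A + B + 1) * natSqFact r M * natSqFact r B * natSqFact r (M + A + B + 1) / natSqFact r A

/-- The exponent of `q` in front of the explicit formula. -/
def cgExp (M A B k₁ k₂ : ℕ) : ℚ :=
  (-(M * (M + A + B + 1)) + (M + B) * k₂ - (M + A) * k₁) / 2

/-- The Clebsch–Gordan coefficient with `j₁ + m₁ = k₁`, `j₂ + m₂ = k₂`, `j₃ + m₃ = i`. -/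
noncomputable def cgNat (h : ℂ) (r : ℕ → ℂ) (M A B k₁ k₂ i : ℕ) : ℂ :=
  if k₁ + k₂ = i + M then
    qpow h (cgExp M A B k₁ k₂) * cgConst r M A B
      * (natSqFact r i / natSqFact r (A + B - i))
      * (1 / (natSqFact r k₁ * natSqFact r (M + B - k₁)))
      * (1 / (natSqFact r k₂ * natSqFact r (M + A - k₂)))
      * cgInner h M A B k₁ ((M + A - k₂ : ℕ) : ℚ) i
  else 0

/-! ### Recursion, highest weight vector and norm of the explicit coefficients -/

section

variable {h : ℂ} {r : ℕ → ℂ} {M A B : ℕ}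

/-- Holds summand by summand: the last factor of [j₁+j₂-m₃-n]! is [(j₁-m₁) + (x-n)], split by the
addition rule. Taking x rational lets x - 1 be used also at x = 0. -/
theorem cgInner_lower (k₁ : ℕ) (x : ℚ) {i : ℕ} (hi : i < A + B)
    (hx : (M + B : ℚ) - k₁ + x = M + A + B - i) :
    qnum h ((M + B : ℚ) - k₁) * qpow h (-x) * cgInner h M A B (k₁ + 1) x (i + 1)
      + qpow h ((M + B : ℚ) - k₁) * qnum h x * cgInner h M A B k₁ (x - 1) (i + 1)
      = cgInner h M A B k₁ x i := by
  simp only [cgInner, Finset.mul_sum]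
  rw [← Finset.sum_add_distrib]
  refine Finset.sum_congr rfl fun n hn => ?_
  have hn' := Finset.mem_range.1 hn
  have e1 : natQFact h (M + A + B - i - n)
      = natQFact h (M + A + B - (i + 1) - n) * qnum h ((M + B : ℚ) - k₁ + (x - n)) := by
    rw [show M + A + B - i - n = M + A + B - (i + 1) - n + 1 by omega, natQFact_succ]
    congr 2
    rw [Nat.sub_sub, Nat.cast_sub (by omega)]
    push_cast
    linarith
  have e2 := qDescFact_add_one h (x - 1) n
  rw [sub_add_cancel] at e2
  have e3 : qpow h (n * (k₁ + 1 : ℕ)) * qpow h (-x) = qpow h (n * k₁) * qpow h (-(x - n)) := by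
    rw [← qpow_add, ← qpow_add]
    push_cast
    ring_nf
  rw [e1, qnum_add]
  linear_combination (qnum h ((M + B : ℚ) - k₁) * (-1) ^ (M - n) * natQFact h (M + A - n)
    * natQFact h (M + A + B - (i + 1) - n)
    / (natQFact h n * natQFact h (M - n) * natQFact h (M + A + B + 1 - n)) * qDescFact h x n) * e3
    - (qpow h ((M + B : ℚ) - k₁) * ((-1) ^ (M - n) * qpow h (n * k₁) * natQFact h (M + A - n)
    * natQFact h (M + A + B - (i + 1) - n)
    / (natQFact h n * natQFact h (M - n) * natQFact h (M + A + B + 1 - n)))) * e2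

theorem sqrt_mul_inv_natSqFact (hr : ∀ k : ℕ, r k ^ 2 = qnum h k) {N a k : ℕ}
    (hr0 : ∀ k, 1 ≤ k → k ≤ N → r k ≠ 0) (ha : a ≤ N) (hk : k ≤ a) :
    r (k + 1) * r (a - k) * (1 / (natSqFact r (k + 1) * natSqFact r (a - (k + 1))))
      = qnum h ((a : ℚ) - k) * (1 / (natSqFact r k * natSqFact r (a - k))) := by
  rw [← Nat.cast_sub hk, ← hr]
  rcases Nat.lt_or_eq_of_le hk with hk | rfl
  · obtain ⟨d, rfl⟩ := Nat.exists_eq_add_of_lt hk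
    rw [show k + d + 1 - k = d + 1 by omega, show k + d + 1 - (k + 1) = d by omega,
      natSqFact_succ, natSqFact_succ]
    have := natSqFact_ne_zero (n := k) hr0 (by omega)
    have := natSqFact_ne_zero (n := d) hr0 (by omega)
    have := hr0 (k + 1) (by omega) (by omega)
    have := hr0 (d + 1) (by omega) (by omega)
    field_simp
  · simp [sqrt_zero hr]

/-- This is the J₋-relation read at one coordinate. The square roots combine into q-numbers, after
which it is `cgInner_lower`. -/
theorem cgNat_lower (hr : ∀ k : ℕ, r k ^ 2 = qnum h k)
    (hq : ∀ k : ℕ, 1 ≤ k → k ≤ M + A + B + 1 → qnum h k ≠ 0) {k₁ k₂ i : ℕ}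
    (hk₁ : k₁ ≤ M + B) (hk₂ : k₂ ≤ M + A) (hi : i < A + B) :
    qpow h ((k₂ : ℚ) - (M + A) / 2) * (r (k₁ + 1) * r (M + B - k₁)
        * cgNat h r M A B (k₁ + 1) k₂ (i + 1))
      + qpow h (-((k₁ : ℚ) - (M + B) / 2)) * (r (k₂ + 1) * r (M + A - k₂)
        * cgNat h r M A B k₁ (k₂ + 1) (i + 1))
      = r (i + 1) * r (A + B - i) * cgNat h r M A B k₁ k₂ i := by
  have hr0 := ne_zero_of_sq_eq_qnum hr hq
  by_cases hk : k₁ + k₂ = i + M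
  · have hk1 : k₁ + 1 + k₂ = i + 1 + M := by omega
    have hk2 : k₁ + (k₂ + 1) = i + 1 + M := by omega
    simp only [cgNat, hk, hk1, hk2, if_true]
    have p1 := sqrt_mul_inv_natSqFact hr hr0 (show M + B ≤ M + A + B + 1 by omega) hk₁
    have p2 := sqrt_mul_inv_natSqFact hr hr0 (show M + A ≤ M + A + B + 1 by omega) hk₂
    have p3 : natSqFact r (i + 1) / natSqFact r (A + B - (i + 1))
        = r (i + 1) * r (A + B - i) * (natSqFact r i / natSqFact r (A + B - i)) := by
      obtain ⟨d, hd⟩ := Nat.exists_eq_add_of_lt hi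
      rw [hd, show i + d + 1 - i = d + 1 by omega, show i + d + 1 - (i + 1) = d by omega,
        natSqFact_succ, natSqFact_succ]
      have := natSqFact_ne_zero (n := d) hr0 (by omega)
      have := hr0 (d + 1) (by omega) (by omega)
      field_simp
    set x : ℚ := ((M + A - k₂ : ℕ) : ℚ) with hx
    have hx' : x = M + A - k₂ := by
      rw [hx, Nat.cast_sub hk₂]
      push_cast
      ring
    have hkq : (k₁ : ℚ) + k₂ = i + M := by exact_mod_cast hk
    have hrec := cgInner_lower (h := h) (M := M) (A := A) (B := B) k₁ x hi
      (by rw [hx']; linarith)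
    have e1 : qpow h ((k₂ : ℚ) - (M + A) / 2) * qpow h (cgExp M A B (k₁ + 1) k₂)
        = qpow h (cgExp M A B k₁ k₂) * qpow h (-x) := by
      rw [← qpow_add, ← qpow_add, hx', cgExp, cgExp]
      push_cast
      ring_nf
    have e2 : qpow h (-((k₁ : ℚ) - (M + B) / 2)) * qpow h (cgExp M A B k₁ (k₂ + 1))
        = qpow h (cgExp M A B k₁ k₂) * qpow h ((M + B : ℚ) - k₁) := by
      rw [← qpow_add, ← qpow_add, cgExp, cgExp]
      push_cast
      ring_nf
    have hx2 : qnum h (((M + A : ℕ) : ℚ) - k₂) = qnum h x := by rw [hx', Nat.cast_add]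
    rw [hx2] at p2
    rw [Nat.cast_add] at p1
    -- When k₂ = M+A the natural subtraction gives 0 instead of x - 1 = -1; the factor [x] = 0 makes
    -- this harmless.
    have hinner : qnum h x * cgInner h M A B k₁ ((M + A - (k₂ + 1) : ℕ) : ℚ) (i + 1)
        = qnum h x * cgInner h M A B k₁ (x - 1) (i + 1) := by
      rcases Nat.lt_or_eq_of_le hk₂ with hlt | rfl
      · congr 2
        rw [hx', Nat.cast_sub hlt]
        push_cast
        ring
      · simp [hx, qnum_zero]
    rw [p3, ← hrec]
    set R := r (i + 1) * r (A + B - i) * (natSqFact r i / natSqFact r (A + B - i)) with hR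
    set C := cgConst r M A B
    set Q1 := 1 / (natSqFact r k₁ * natSqFact r (M + B - k₁))
    set Q2 := 1 / (natSqFact r k₂ * natSqFact r (M + A - k₂))
    set I1 := cgInner h M A B (k₁ + 1) x (i + 1)
    set I2 := cgInner h M A B k₁ (x - 1) (i + 1)
    set I3 := cgInner h M A B k₁ ((M + A - (k₂ + 1) : ℕ) : ℚ) (i + 1)
    set W1 := 1 / (natSqFact r (k₁ + 1) * natSqFact r (M + B - (k₁ + 1)))
    set W2 := 1 / (natSqFact r (k₂ + 1) * natSqFact r (M + A - (k₂ + 1)))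
    calc _ = (qpow h ((k₂ : ℚ) - (M + A) / 2) * qpow h (cgExp M A B (k₁ + 1) k₂))
          * (r (k₁ + 1) * r (M + B - k₁) * W1) * (C * R * Q2 * I1)
        + (qpow h (-((k₁ : ℚ) - (M + B) / 2)) * qpow h (cgExp M A B k₁ (k₂ + 1)))
          * (r (k₂ + 1) * r (M + A - k₂) * W2) * (C * R * Q1 * I3) := by ring
      _ = qpow h (cgExp M A B k₁ k₂) * (C * R * Q1 * Q2)
            * (qnum h ((M + B : ℚ) - k₁) * qpow h (-x) * I1)
          + qpow h (cgExp M A B k₁ k₂) * (C * R * Q1 * Q2)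
            * qpow h ((M + B : ℚ) - k₁) * (qnum h x * I3) := by
        rw [e1, e2, p1, p2]
        ring
      _ = _ := by
        rw [hinner, hR]
        ring
  · have hk1 : ¬k₁ + 1 + k₂ = i + 1 + M := by omega
    have hk2 : ¬k₁ + (k₂ + 1) = i + 1 + M := by omega
    simp [cgNat, hk, hk1, hk2]

/-- The coefficients of the highest weight vector. -/
theorem cgNat_top (hr : ∀ k : ℕ, r k ^ 2 = qnum h k)
    (hq : ∀ k : ℕ, 1 ≤ k → k ≤ M + A + B + 1 → qnum h k ≠ 0) {T U : ℕ} (hM : T + U = M) :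
    cgNat h r M A B (B + T) (A + U) (A + B)
      = cgConst r M A B * natSqFact r (A + B) / (natQFact h B * natQFact h (M + A + B + 1))
        * ((-1) ^ U * qpow h (cgExp M A B (B + T) (A + U) + T * (M + A + B + 1))
          * (natSqFact r (B + T) * natSqFact r (A + U) / (natSqFact r T * natSqFact r U))) := by
  have hr0 := ne_zero_of_sq_eq_qnum hr hq
  have nz : ∀ n, n ≤ M + A + B + 1 → natQFact h n ≠ 0 := fun n => natQFact_ne_zero hq
  have inner : cgInner h M A B (B + T) (T : ℚ) (A + B)
      = (-1) ^ U * qpow h (T * (M + A + B + 1)) * (natQFact h (B + T) * natQFact h (A + U))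
        / (natQFact h B * natQFact h (M + A + B + 1)) := by
    have hV := sum_alternating_vandermonde (h := h) B T (M + A) (by omega)
      fun k h1 h2 => hq k h1 (by omega)
    -- At i = A+B the factorial [M-n]! cancels, and the terms with n > T vanish; what is left is the
    -- alternating Vandermonde sum with N = M+A.
    have hsum : cgInner h M A B (B + T) (T : ℚ) (A + B) = (-1) ^ M * natQFact h T *
        ∑ n ∈ Finset.range (T + 1), (-1) ^ n * qpow h (n * (B + T)) * natQFact h (M + A - n)
          / (natQFact h n * natQFact h (T - n) * natQFact h (M + A + B + 1 - n)) := by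
      rw [cgInner, Finset.mul_sum]
      refine (Finset.sum_subset (Finset.range_mono (by omega)) fun n _ hn => ?_).symm.trans
        (Finset.sum_congr rfl fun n hn => ?_)
      · rw [qDescFact_natCast_of_lt, mul_zero]
        simpa using hn
      · have hn' := Finset.mem_range.1 hn
        have hD := qDescFact_mul_natQFact h (show n ≤ T by omega)
        have hs : (-1 : ℂ) ^ (M - n) = (-1) ^ M * (-1) ^ n := by
          rw [← pow_add, show M + n = M - n + 2 * n by omega, pow_add, pow_mul]
          simp
        rw [show M + A + B - (A + B) - n = M - n by omega, hs, ← hD]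
        have := nz n (by omega)
        have := nz (M - n) (by omega)
        have := nz (T - n) (by omega)
        have := nz (M + A + B + 1 - n) (by omega)
        push_cast
        field_simp
    rw [hsum, hV, show M + A - T = A + U by omega]
    have hs : (-1 : ℂ) ^ U = (-1) ^ M * (-1) ^ T := by
      rw [← pow_add, show M + T = U + 2 * T by omega, pow_add, pow_mul]
      simp
    have := nz T (by omega)
    have := nz B (by omega)
    have := nz (M + A + B + 1) (by omega)
    rw [hs]
    push_cast
    field_simp
  rw [cgNat, if_pos (by omega), show M + A - (A + U) = T by omega, inner, Nat.sub_self,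
    natSqFact_zero, show M + B - (B + T) = U by omega, ← natSqFact_sq hr (B + T),
    ← natSqFact_sq hr (A + U), qpow_add]
  have := natSqFact_ne_zero (n := T) hr0 (by omega)
  have := natSqFact_ne_zero (n := U) hr0 (by omega)
  have := natSqFact_ne_zero (n := B + T) hr0 (by omega)
  have := natSqFact_ne_zero (n := A + U) hr0 (by omega)
  have := nz B (by omega)
  have := nz (M + A + B + 1) (by omega)
  field_simp

/-- Two neighbouring coordinates of the highest weight vector enter. In product form they have
opposite signs, and the powers of q match after multiplication by the coproduct factors. -/
theorem cgNat_top_raise (hr : ∀ k : ℕ, r k ^ 2 = qnum h k)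
    (hq : ∀ k : ℕ, 1 ≤ k → k ≤ M + A + B + 1 → qnum h k ≠ 0) {T U : ℕ} (hM : T + U + 1 = M) :
    qpow h (((A + U + 1 : ℕ) : ℚ) - (M + A) / 2) * (r (U + 1) * r (B + T + 1)
        * cgNat h r M A B (B + T) (A + U + 1) (A + B))
      + qpow h (-(((B + T + 1 : ℕ) : ℚ) - (M + B) / 2)) * (r (T + 1) * r (A + U + 1)
        * cgNat h r M A B (B + T + 1) (A + U) (A + B)) = 0 := by
  have hr0 := ne_zero_of_sq_eq_qnum hr hq
  have t1 := cgNat_top (A := A) (B := B) hr hq (T := T) (U := U + 1) (by omega)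
  have t2 := cgNat_top (A := A) (B := B) hr hq (T := T + 1) (U := U) (by omega)
  rw [← add_assoc] at t1 t2
  have e : qpow h (((A + U + 1 : ℕ) : ℚ) - (M + A) / 2)
        * qpow h (cgExp M A B (B + T) (A + U + 1) + T * (M + A + B + 1))
      = qpow h (-(((B + T + 1 : ℕ) : ℚ) - (M + B) / 2))
        * qpow h (cgExp M A B (B + T + 1) (A + U) + (T + 1 : ℕ) * (M + A + B + 1)) := by
    rw [← qpow_add, ← qpow_add, cgExp, cgExp]
    congr 1
    rw [← hM]
    push_cast
    ring
  rw [t1, t2, natSqFact_succ r (A + U), natSqFact_succ r U, natSqFact_succ r (B + T),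
    natSqFact_succ r T]
  have := natSqFact_ne_zero (n := T) hr0 (by omega)
  have := natSqFact_ne_zero (n := U) hr0 (by omega)
  have := hr0 (T + 1) (by omega) (by omega)
  have := hr0 (U + 1) (by omega) (by omega)
  set X := cgConst r M A B * natSqFact r (A + B) / (natQFact h B * natQFact h (M + A + B + 1))
  rw [show r (U + 1) * r (B + T + 1) * (X * ((-1) ^ (U + 1)
        * qpow h (cgExp M A B (B + T) (A + U + 1) + T * (M + A + B + 1))
        * (natSqFact r (B + T) * (natSqFact r (A + U) * r (A + U + 1))
          / (natSqFact r T * (natSqFact r U * r (U + 1))))))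
      = qpow h (cgExp M A B (B + T) (A + U + 1) + T * (M + A + B + 1))
        * -((-1) ^ U * X * r (B + T + 1) * natSqFact r (B + T) * natSqFact r (A + U)
          * r (A + U + 1) / (natSqFact r T * natSqFact r U)) by
    rw [pow_succ]
    field_simp, ← mul_assoc, e]
  field_simp
  ring

theorem cgConst_sq (hr : ∀ k : ℕ, r k ^ 2 = qnum h k) :
    (cgConst r M A B * natSqFact r (A + B)) ^ 2
      = natQFact h (A + B + 1) * natQFact h M * natQFact h B * natQFact h (M + A + B + 1)
        / natQFact h A := by
  simp only [cgConst, mul_pow, div_pow, natSqFact_sq hr, hr, natQFact_succ h (A + B)]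
  push_cast
  ring

/-- Squaring removes the signs and square roots, and leaves precisely the summands of the
convolution formula. -/
theorem sum_cgNat_top_sq (hr : ∀ k : ℕ, r k ^ 2 = qnum h k)
    (hq : ∀ k : ℕ, 1 ≤ k → k ≤ M + A + B + 1 → qnum h k ≠ 0) :
    ∑ T ∈ Finset.range (M + 1), cgNat h r M A B (B + T) (A + (M - T)) (A + B) ^ 2 = 1 := by
  have nz : ∀ n, n ≤ M + A + B + 1 → natQFact h n ≠ 0 := fun n => natQFact_ne_zero hq
  have hV := sum_convolution_vandermonde (h := h) M A B fun k h1 h2 => hq k h1 (by omega)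
  have hterm : ∀ T ∈ Finset.range (M + 1), cgNat h r M A B (B + T) (A + (M - T)) (A + B) ^ 2
      = natQFact h (A + B + 1) * natQFact h M
        / (natQFact h A * natQFact h B * natQFact h (M + A + B + 1))
        * (qpow h (T * (A + 1) - (M - T) * (B + 1))
        * (natQFact h (B + T) * natQFact h (A + (M - T))
          / (natQFact h T * natQFact h (M - T)))) := by
    intro T hT
    have hT' := Finset.mem_range.1 hT
    have e : qpow h (cgExp M A B (B + T) (A + (M - T)) + T * (M + A + B + 1)) ^ 2
        = qpow h (T * (A + 1) - (M - T) * (B + 1)) := by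
      rw [sq, ← qpow_add, cgExp]
      congr 1
      rw [Nat.cast_add A, Nat.cast_sub (by omega)]
      push_cast
      ring
    rw [cgNat_top hr hq (show T + (M - T) = M by omega), mul_pow, div_pow, cgConst_sq hr, mul_pow,
      mul_pow, div_pow, mul_pow, mul_pow, mul_pow, e, natSqFact_sq hr, natSqFact_sq hr, natSqFact_sq hr,
      natSqFact_sq hr, ← pow_mul, mul_comm (M - T) 2, pow_mul, neg_one_sq, one_pow]
    have := nz B (by omega)
    have := nz A (by omega)
    have := nz (M + A + B + 1) (by omega)
    field_simp
  rw [Finset.sum_congr rfl hterm, ← Finset.mul_sum, hV,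
    show A + B + M + 1 = M + A + B + 1 by omega]
  have := nz B (by omega)
  have := nz A (by omega)
  have := nz M (by omega)
  have := nz (A + B + 1) (by omega)
  have := nz (M + A + B + 1) (by omega)
  field_simp

/-- The explicit coefficients as vectors in `j₁ ⊗ j₂`. -/
noncomputable def cgVec (h : ℂ) (r : ℕ → ℂ) (M A B i : ℕ)
    (p : Fin (M + B + 1) × Fin (M + A + 1)) : ℂ :=
  cgNat h r M A B p.1 p.2 i

theorem cgVec_hasLevel (i : ℕ) : HasLevel (cgVec h r M A B i) (i + M) := by
  intro p hp
  by_contra h0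
  refine hp (if_neg fun h1 => h0 ?_)
  exact_mod_cast h1

theorem cgVec_lower (hr : ∀ k : ℕ, r k ^ 2 = qnum h k)
    (hq : ∀ k : ℕ, 1 ≤ k → k ≤ M + A + B + 1 → qnum h k ≠ 0) {i : ℕ} (hi : i < A + B) :
    deltaJminus h r (M + B) (M + A) *ᵥ cgVec h r M A B (i + 1)
      = (r (i + 1) * r (A + B - i)) • cgVec h r M A B i := by
  have hJ : ∀ (a : ℕ) (k : Fin (a + 1)) (y : ℕ → ℂ), (Jminus r a *ᵥ fun j => y j) k
      = r (k + 1) * r (a - k) * y (k + 1) := by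
    rintro a ⟨k, hk⟩ y
    rcases Nat.lt_succ_iff_lt_or_eq.1 hk with hn | rfl
    · rw [Jminus_mulVec_of_lt r hn]
    · exact (Jminus_mulVec_last r k _).trans (by simp [sqrt_zero hr])
  ext ⟨k₁, k₂⟩
  rw [deltaJminus_mulVec]
  simp only [cgVec, Pi.smul_apply, smul_eq_mul]
  rw [hJ _ k₁ fun j => cgNat h r M A B j k₂ (i + 1), hJ _ k₂ fun j => cgNat h r M A B k₁ j (i + 1),
    ← cgNat_lower hr hq (by have := k₁.2; omega) (by have := k₂.2; omega) hi]
  simp [wt, spin]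

theorem cgVec_top_raise (hr : ∀ k : ℕ, r k ^ 2 = qnum h k)
    (hq : ∀ k : ℕ, 1 ≤ k → k ≤ M + A + B + 1 → qnum h k ≠ 0) :
    deltaJplus h r (M + B) (M + A) *ᵥ cgVec h r M A B (A + B) = 0 := by
  ext p
  by_contra h0
  have hl := (cgVec_hasLevel (A + B)).deltaJplus p h0
  refine h0 ?_
  -- A nonzero coordinate has level M+A+B+1, which forces k₁ > B and k₂ > A; hence both summands of
  -- Δ(J₊) are in the interior case.
  rcases p with ⟨⟨k₁, hk₁⟩, ⟨k₂, hk₂⟩⟩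
  push_cast at hl
  obtain ⟨T, rfl⟩ : ∃ T, k₁ = B + T + 1 := ⟨k₁ - B - 1, by omega⟩
  obtain ⟨U, rfl⟩ : ∃ U, k₂ = A + U + 1 := ⟨k₂ - A - 1, by omega⟩
  have hM : T + U + 1 = M := by omega
  rw [deltaJplus_mulVec, Jplus_mulVec_succ r (by omega), Jplus_mulVec_succ r (by omega)]
  refine Eq.trans ?_ (cgNat_top_raise (A := A) (B := B) hr hq hM)
  rw [show M + B - (B + T) = U + 1 by omega, show M + A - (A + U) = T + 1 by omega]
  simp [cgVec, wt, spin]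

theorem cgVec_top_norm (hr : ∀ k : ℕ, r k ^ 2 = qnum h k)
    (hq : ∀ k : ℕ, 1 ≤ k → k ≤ M + A + B + 1 → qnum h k ≠ 0) :
    cgVec h r M A B (A + B) ⬝ᵥ cgVec h r M A B (A + B) = 1 := by
  rw [← sum_cgNat_top_sq (A := A) (B := B) hr hq, Finset.sum_range]
  symm
  refine Fintype.sum_of_injective (fun T : Fin (M + 1) =>
    ((⟨B + T, by omega⟩, ⟨A + (M - T), by omega⟩) : Fin (M + B + 1) × Fin (M + A + 1)))
    (fun T T' hT => ?_) _ _ (fun p hp => ?_) fun T => ?_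
  · simp only [Prod.mk.injEq, Fin.mk.injEq] at hT
    exact Fin.ext (by omega)
  · by_contra h0
    have hl := cgVec_hasLevel _ p (left_ne_zero_of_mul h0)
    rcases p with ⟨⟨k₁, hk₁⟩, ⟨k₂, hk₂⟩⟩
    push_cast at hl
    refine hp ⟨⟨k₁ - B, by omega⟩, ?_⟩
    simp only [Prod.mk.injEq, Fin.mk.injEq]
    omega
  · rw [sq]
    rfl

theorem cgVec_isCoupledBasis (hr : ∀ k : ℕ, r k ^ 2 = qnum h k)
    (hq : ∀ k : ℕ, 1 ≤ k → k ≤ M + A + B + 1 → qnum h k ≠ 0) :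
    IsCoupledBasis h r (M + B) (M + A) (A + B) fun i => cgVec h r M A B i :=
  (isCanonicalBasis_of_lower hr hq (fun n _ => cgVec_hasLevel n) (fun _ hn => cgVec_lower hr hq hn)
    (cgVec_top_raise hr hq)).isCoupledBasis hr hq (cgVec_top_norm hr hq)

end

/-! ### Comparison with the two explicit formulas -/

theorem spin_add_sub_spin (M A B : ℕ) : spin (M + B) + spin (M + A) - spin (A + B) = (M : ℕ) := by
  simp only [spin]
  push_cast
  ring

theorem spin_sub_add_spin (M A B : ℕ) : spin (M + B) - spin (M + A) + spin (A + B) = (B : ℕ) := by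
  simp only [spin]
  push_cast
  ring

theorem neg_spin_add_add_spin (M A B : ℕ) :
    -spin (M + B) + spin (M + A) + spin (A + B) = (A : ℕ) := by
  simp only [spin]
  push_cast
  ring

theorem spin_add_spin_add_spin_add_one (M A B : ℕ) :
    spin (M + B) + spin (M + A) + spin (A + B) + 1 = (M + A + B + 1 : ℕ) := by
  simp only [spin]
  push_cast
  ring

theorem spin_add_wt (a : ℕ) (i : Fin (a + 1)) : spin a + wt a i = (i : ℕ) := by
  simp only [spin, wt]
  ring

theorem spin_sub_wt (a : ℕ) (i : Fin (a + 1)) : spin a - wt a i = (a - i : ℕ) := by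
  have := i.2
  rw [Nat.cast_sub (by omega)]
  simp only [spin, wt]
  ring

theorem two_mul_spin (a : ℕ) : 2 * spin a = (a : ℕ) := by
  simp only [spin]
  ring

theorem spin_add_spin_sub_wt (M A B : ℕ) (i : Fin (A + B + 1)) :
    spin (M + B) + spin (M + A) - wt (A + B) i = (M + A + B - i : ℕ) := by
  have := i.2
  rw [Nat.cast_sub (by omega)]
  simp only [spin, wt]
  push_cast
  ring

theorem floor_two_mul_spin_add_one (a : ℕ) : ⌊2 * spin a + 1⌋₊ = a + 1 := by
  rw [two_mul_spin, ← Nat.cast_add_one, Nat.floor_natCast]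

theorem qfact_natCast (h : ℂ) (n : ℕ) : qfact h (n : ℚ) = natQFact h n := qfact_eq h rfl

theorem sqfact_natCast (r : ℕ → ℂ) (n : ℕ) : sqfact r (n : ℚ) = natSqFact r n := sqfact_eq r rfl

section Formulas

variable {h : ℂ} {r : ℕ → ℂ} {M A B : ℕ}

theorem wt_add_wt_eq_iff (i₁ : Fin (M + B + 1)) (i₂ : Fin (M + A + 1)) (i₃ : Fin (A + B + 1)) :
    wt (M + B) i₁ + wt (M + A) i₂ = wt (A + B) i₃ ↔ (i₁ : ℕ) + i₂ = i₃ + M := by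
  rw [← sub_eq_zero, wt_add_wt M A B (i₁, i₂), sub_eq_zero]
  exact_mod_cast Iff.rfl

theorem cgExp_eq (i₁ : Fin (M + B + 1)) (i₂ : Fin (M + A + 1)) :
    -(1 / 2) * (spin (M + B) + spin (M + A) - spin (A + B))
        * (spin (M + B) + spin (M + A) + spin (A + B) + 1)
        + spin (M + B) * wt (M + A) i₂ - spin (M + A) * wt (M + B) i₁
      = cgExp M A B i₁ i₂ := by
  simp only [wt, spin, cgExp]
  push_cast
  ring

theorem cgInner_natCast (hq : ∀ k : ℕ, 1 ≤ k → k ≤ M + A + B + 1 → qnum h k ≠ 0) (k₁ i : ℕ)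
    {l : ℕ} (hl : l ≤ M + A) :
    cgInner h M A B k₁ (l : ℚ) i = natQFact h l * ∑ n ∈ Finset.range (min M l + 1),
      (-1) ^ (M - n) * qpow h (n * k₁) * natQFact h (M + A - n)
      * natQFact h (M + A + B - i - n)
      / (natQFact h n * natQFact h (M - n) * natQFact h (l - n)
        * natQFact h (M + A + B + 1 - n)) := by
  have nz : ∀ n, n ≤ M + A + B + 1 → natQFact h n ≠ 0 := fun n => natQFact_ne_zero hq
  rw [cgInner, Finset.mul_sum]
  refine (Finset.sum_subset (Finset.range_mono (by omega)) fun n hn hn' => ?_).symm.trans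
    (Finset.sum_congr rfl fun n hn => ?_)
  · rw [Finset.mem_range] at hn hn'
    rw [qDescFact_natCast_of_lt h (by omega), mul_zero]
  · have hn := Finset.mem_range.1 hn
    rw [← qDescFact_mul_natQFact h (show n ≤ l by omega)]
    have := nz (l - n) (by omega)
    field_simp

theorem cgSum_eq (hr : ∀ k : ℕ, r k ^ 2 = qnum h k)
    (hq : ∀ k : ℕ, 1 ≤ k → k ≤ M + A + B + 1 → qnum h k ≠ 0)
    (i₁ : Fin (M + B + 1)) (i₂ : Fin (M + A + 1)) (i₃ : Fin (A + B + 1)) :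
    cgSum h r (spin (M + B)) (wt (M + B) i₁) (spin (M + A)) (wt (M + A) i₂)
      (spin (A + B)) (wt (A + B) i₃) = cgNat h r M A B i₁ i₂ i₃ := by
  have hr0 := ne_zero_of_sq_eq_qnum hr hq
  have h₁ := i₁.2
  have h₂ := i₂.2
  have h₃ := i₃.2
  rw [cgSum, cgNat]
  simp only [wt_add_wt_eq_iff]
  split_ifs with hk
  swap
  · rfl
  rw [cgExp_eq, floor_two_mul_spin_add_one]
  simp only [spin_add_sub_spin, spin_sub_add_spin,
    neg_spin_add_add_spin, spin_add_spin_add_spin_add_one, spin_add_wt, spin_sub_wt,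
    two_mul_spin, spin_add_spin_sub_wt, sqfact_natCast, qfact_natCast, Nat.floor_natCast, ← Nat.cast_min]
  rw [cgInner_natCast hq _ _ (Nat.sub_le _ _), cgConst, ← natSqFact_sq hr (M + A - i₂)]
  have hsum : ∀ n ∈ Finset.range (min M (M + A - i₂) + 1),
      (-1) ^ ⌊(M : ℚ) - n⌋₊ * qpow h (n * ((i₁ : ℕ) : ℚ)) * qfact h (((M + A : ℕ) : ℚ) - n)
        * qfact h (((M + A + B - i₃ : ℕ) : ℚ) - n) / (natQFact h n * qfact h ((M : ℚ) - n)
        * qfact h (((M + A - i₂ : ℕ) : ℚ) - n) * qfact h (((M + A + B + 1 : ℕ) : ℚ) - n))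
      = (-1) ^ (M - n) * qpow h (n * ((i₁ : ℕ) : ℚ)) * natQFact h (M + A - n)
        * natQFact h (M + A + B - i₃ - n) / (natQFact h n * natQFact h (M - n)
        * natQFact h (M + A - i₂ - n) * natQFact h (M + A + B + 1 - n)) := by
    intro n hn
    have hn := Finset.mem_range.1 hn
    rw [← Nat.cast_sub (by omega), ← Nat.cast_sub (by omega), ← Nat.cast_sub (by omega),
      ← Nat.cast_sub (by omega), ← Nat.cast_sub (by omega), Nat.floor_natCast]
    simp only [qfact_natCast]
  rw [Finset.sum_congr rfl hsum]
  have := natSqFact_ne_zero (n := M + A - i₂) hr0 (by omega)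
  generalize Finset.sum (M := ℂ) (Finset.range (min M (M + A - i₂) + 1)) _ = X
  generalize natSqFact r (M + A - i₂) = s at *
  -- √[j₂-m₂]! stands in the numerator of the target formula, while `cgNat` has it in the
  -- denominator next to the full factorial extracted from `cgInner`.
  have hs : s⁻¹ * s ^ 2 = s := by
    rw [sq, inv_mul_cancel_left₀ this]
  linear_combination -(qpow h (cgExp M A B i₁ i₂) * (r (A + B + 1) * natSqFact r M * natSqFact r B
    * natSqFact r (M + A + B + 1) * natSqFact r i₃ / (natSqFact r A * natSqFact r i₁
    * natSqFact r (M + B - i₁) * natSqFact r i₂ * natSqFact r (A + B - i₃))) * X) * hs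

theorem qpow_pow (x : ℚ) (n : ℕ) : qpow h x ^ n = qpow h (n * x) := by
  rw [qpow, qpow, ← Complex.exp_nat_mul]
  push_cast
  ring_nf

/-- Each factor is 1 - q^(-2(x-k)) = q^(-(x-k)) (q - q⁻¹) [x-k]. This form converts every Pochhammer
symbol of the series; the one of q² itself is the case x = -1. -/
theorem qPoch_neg (hd : qpow h 1 - qpow h (-1) ≠ 0) (x : ℚ) (n : ℕ) :
    qPoch (qpow h 2) (qpow h (-2 * x)) n
      = qpow h (-x * n + n * (n - 1) / 2) * (qpow h 1 - qpow h (-1)) ^ n * qDescFact h x n := by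
  induction n with
  | zero => simp [qPoch, qpow_zero]
  | succ n ih =>
    have e1 : 1 - qpow h (-2 * x) * qpow h 2 ^ n
        = qpow h (-(x - n)) * (qpow h 1 - qpow h (-1)) * qnum h (x - n) := by
      rw [qnum, mul_assoc, mul_div_cancel₀ _ hd, mul_sub, mul_comm (qpow h (-(x - n))),
        qpow_mul_qpow_neg, qpow_pow, ← qpow_add, ← qpow_add]
      ring_nf
    have e2 : qpow h (-x * (n + 1 : ℕ) + (n + 1 : ℕ) * ((n + 1 : ℕ) - 1) / 2)
        = qpow h (-x * n + n * (n - 1) / 2) * qpow h (-(x - n)) := by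
      rw [← qpow_add]
      push_cast
      ring_nf
    rw [qPoch, Finset.prod_range_succ, ← qPoch, ih, e1, e2, qDescFact_succ, pow_succ]
    ring

theorem qPoch_self (hd : qpow h 1 - qpow h (-1) ≠ 0) (n : ℕ) :
    qPoch (qpow h 2) (qpow h 2) n
      = (-1) ^ n * qpow h (n * (n + 1) / 2) * (qpow h 1 - qpow h (-1)) ^ n * natQFact h n := by
  have h1 : qDescFact h (-1) n = (-1) ^ n * natQFact h n := by
    induction n with
    | zero => simp
    | succ n ih =>
      rw [qDescFact_succ, ih, natQFact_succ, show (-1 : ℚ) - n = -(n + 1) by ring, qnum_neg,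
        pow_succ]
      ring
  have := qPoch_neg hd (-1) n
  rw [h1] at this
  rw [show (-2 : ℚ) * -1 = 2 by norm_num] at this
  rw [this, show -(-1 : ℚ) * n + n * (n - 1) / 2 = n * (n + 1) / 2 by ring]
  ring

/-- Terms agree one by one: the powers of q - q⁻¹ balance, three above and three below, and weight
conservation `hx` reduces the powers of q to q^(n k₁). -/
theorem phi32_eq (hq : ∀ k : ℕ, 1 ≤ k → k ≤ M + A + B + 1 → qnum h k ≠ 0) {k₁ i : ℕ} (x : ℚ)
    (hi : i ≤ A + B) (hx : (M : ℚ) + i = k₁ + (M + A - x)) :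
    natQFact h (M + A) * natQFact h (M + A + B - i) * ((-1) ^ M
      * phi32 (qpow h (-2 * M)) (qpow h (-2 * (M + A + B + 1))) (qpow h (-2 * x))
        (qpow h (-2 * (M + A))) (qpow h (-2 * (M + A + B - i))) (qpow h 2)
        (qpow h (2 * (k₁ + 1))))
      = natQFact h M * natQFact h (M + A + B + 1) * cgInner h M A B k₁ x i := by
  have nz : ∀ n, n ≤ M + A + B + 1 → natQFact h n ≠ 0 := fun n => natQFact_ne_zero hq
  have hd := sub_ne_zero_of_qnum_ne_zero (hq 1 le_rfl (by omega))
  rw [phi32, tsum_eq_sum (s := Finset.range (M + 1)), cgInner, Finset.mul_sum, Finset.mul_sum,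
    Finset.mul_sum]
  · refine Finset.sum_congr rfl fun n hn => ?_
    have hn := Finset.mem_range.1 hn
    have d1 := qDescFact_mul_natQFact h (show n ≤ M by omega)
    have d2 := qDescFact_mul_natQFact h (show n ≤ M + A + B + 1 by omega)
    have d3 := qDescFact_mul_natQFact h (show n ≤ M + A by omega)
    have d4 := qDescFact_mul_natQFact h (show n ≤ M + A + B - i by omega)
    have ei : ((M + A + B - i : ℕ) : ℚ) = M + A + B - i := by
      rw [Nat.cast_sub (by omega)]
      push_cast
      ring
    rw [ei] at d4
    push_cast at d2 d3
    have z3 : qDescFact h ((M : ℚ) + A) n ≠ 0 := by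
      intro h0
      rw [h0, zero_mul] at d3
      exact nz (M + A) (by omega) d3.symm
    have z4 : qDescFact h ((M : ℚ) + A + B - i) n ≠ 0 := by
      intro h0
      rw [h0, zero_mul] at d4
      exact nz (M + A + B - i) (by omega) d4.symm
    have hs : (-1 : ℂ) ^ (M - n) = (-1) ^ M * (-1) ^ n := by
      rw [← pow_add, show M + n = M - n + 2 * n by omega, pow_add, pow_mul]
      simp
    have e : qpow h (-(M : ℚ) * n + n * (n - 1) / 2)
        * qpow h (-((M : ℚ) + A + B + 1) * n + n * (n - 1) / 2)
        * qpow h (-x * n + n * (n - 1) / 2) * qpow h (n * (2 * (k₁ + 1)))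
        = qpow h (-((M : ℚ) + A) * n + n * (n - 1) / 2)
        * qpow h (-((M : ℚ) + A + B - i) * n + n * (n - 1) / 2) * qpow h (n * (n + 1) / 2)
        * qpow h (n * k₁) := by
      simp only [← qpow_add]
      congr 1
      linear_combination -(n : ℚ) * hx
    simp only [qPoch_self hd, qPoch_neg hd, qpow_pow]
    rw [hs, ← d1, ← d2, ← d3, ← d4]
    have := nz n (by omega)
    have := nz (M - n) (by omega)
    have := nz (M + A + B + 1 - n) (by omega)
    have := qpow_ne_zero h (-((M : ℚ) + A) * n + n * (n - 1) / 2)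
    have := qpow_ne_zero h (-((M : ℚ) + A + B - i) * n + n * (n - 1) / 2)
    have := qpow_ne_zero h ((n : ℚ) * (n + 1) / 2)
    have hs2 : ((-1 : ℂ) ^ n) * (-1) ^ n = 1 := by
      rw [← mul_pow]
      simp
    generalize qpow h (-(M : ℚ) * n + n * (n - 1) / 2) = a₁ at *
    generalize qpow h (-((M : ℚ) + A + B + 1) * n + n * (n - 1) / 2) = a₂ at *
    generalize qpow h (-x * n + n * (n - 1) / 2) = a₃ at *
    generalize qpow h (n * (2 * ((k₁ : ℚ) + 1))) = a₄ at *
    generalize qpow h (-((M : ℚ) + A) * n + n * (n - 1) / 2) = b₁ at *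
    generalize qpow h (-((M : ℚ) + A + B - i) * n + n * (n - 1) / 2) = b₂ at *
    generalize qpow h ((n : ℚ) * (n + 1) / 2) = b₃ at *
    generalize qpow h ((n : ℚ) * k₁) = b₄ at *
    generalize qDescFact h ((M : ℚ) + A) n = D₁ at *
    generalize qDescFact h ((M : ℚ) + A + B - i) n = D₂ at *
    generalize qDescFact h ((M : ℚ) + A + B + 1) n = D₃ at *
    generalize qDescFact h (M : ℚ) n = D₄ at *
    generalize qDescFact h x n = D₅ at *
    generalize natQFact h n = N₁ at *
    generalize natQFact h (M - n) = N₂ at *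
    generalize natQFact h (M + A + B + 1 - n) = N₃ at *
    generalize (qpow h 1 - qpow h (-1)) = δ at *
    generalize (-1 : ℂ) ^ n = σ at *
    have hσ : σ ≠ 0 := left_ne_zero_of_mul_eq_one hs2
    field_simp
    rw [pow_two, hs2]
    linear_combination natQFact h (M + A - n) * natQFact h (M + A + B - i - n) * D₄ * D₃ * D₅ * e
  -- For n > M the first numerator symbol vanishes, so the term is 0 even if a denominator vanishes
  -- too (x / 0 = 0).
  · intro n hn
    have : qPoch (qpow h 2) (qpow h (-2 * M)) n = 0 := by
      rw [qPoch_neg hd, qDescFact_natCast_of_lt h (by simpa using hn), mul_zero]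
    rw [this]
    simp only [zero_mul, zero_div]

theorem cgPhi_eq (hr : ∀ k : ℕ, r k ^ 2 = qnum h k)
    (hq : ∀ k : ℕ, 1 ≤ k → k ≤ M + A + B + 1 → qnum h k ≠ 0)
    (i₁ : Fin (M + B + 1)) (i₂ : Fin (M + A + 1)) (i₃ : Fin (A + B + 1)) :
    cgPhi h r (spin (M + B)) (wt (M + B) i₁) (spin (M + A)) (wt (M + A) i₂)
      (spin (A + B)) (wt (A + B) i₃) = cgNat h r M A B i₁ i₂ i₃ := by
  have hr0 := ne_zero_of_sq_eq_qnum hr hq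
  have h₁ := i₁.2
  have h₂ := i₂.2
  have h₃ := i₃.2
  rw [cgPhi, cgNat]
  simp only [wt_add_wt_eq_iff]
  split_ifs with hk
  swap
  · rfl
  have hkq : ((i₁ : ℕ) : ℚ) + ((i₂ : ℕ) : ℚ) = (i₃ : ℕ) + M := by exact_mod_cast hk
  have a1 : 2 * (-spin (M + B) - spin (M + A) + spin (A + B)) = -2 * M := by
    simp only [spin]
    push_cast
    ring
  have a2 : 2 * (-spin (M + B) - spin (M + A) - spin (A + B) - 1) = -2 * (M + A + B + 1) := by
    simp only [spin]
    push_cast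
    ring
  have a3 : 2 * (-spin (M + A) + wt (M + A) i₂) = -2 * (M + A - i₂ : ℕ) := by
    rw [← spin_sub_wt]
    ring
  have b1 : 2 * (-2 * spin (M + A)) = -2 * (M + A) := by
    simp only [spin]
    push_cast
    ring
  have b2 : 2 * (-spin (M + B) - spin (M + A) + wt (A + B) i₃) = -2 * (M + A + B - i₃) := by
    simp only [spin, wt]
    push_cast
    ring
  have hphi := phi32_eq hq (k₁ := i₁) (i := i₃) ((M + A - i₂ : ℕ) : ℚ) (by omega) (by
    rw [Nat.cast_sub (by omega)]
    push_cast
    linarith)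
  rw [cgExp_eq, floor_two_mul_spin_add_one]
  simp only [spin_add_sub_spin, spin_sub_add_spin,
    neg_spin_add_add_spin, spin_add_spin_add_spin_add_one, spin_add_wt, spin_sub_wt,
    two_mul_spin, spin_add_spin_sub_wt, sqfact_natCast, qfact_natCast, Nat.floor_natCast, a1, a2, a3, b1, b2]
  have n1 := natSqFact_ne_zero (n := M) hr0 (by omega)
  have n2 := natSqFact_ne_zero (n := M + A + B + 1) hr0 (by omega)
  rw [cgConst]
  rw [← natSqFact_sq hr M, ← natSqFact_sq hr (M + A + B + 1)] at hphi
  generalize natSqFact r M = s₁ at *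
  generalize natSqFact r A = s₂ at *
  generalize natSqFact r B = s₃ at *
  generalize natSqFact r (M + A + B + 1) = s₄ at *
  generalize natSqFact r i₁ = s₅ at *
  generalize natSqFact r (M + B - i₁) = s₆ at *
  generalize natSqFact r i₂ = s₇ at *
  generalize natSqFact r (M + A - i₂) = s₈ at *
  generalize natSqFact r i₃ = s₉ at *
  generalize natSqFact r (A + B - i₃) = s₁₀ at *
  generalize phi32 _ _ _ _ _ _ _ = Φ at *
  generalize cgInner _ _ _ _ _ _ _ = I at *
  generalize natQFact h (M + A) = t₁ at *
  generalize natQFact h (M + A + B - i₃) = t₂ at *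
  generalize qpow h (cgExp M A B i₁ i₂) = E at *
  generalize r (A + B + 1) = ρ at *
  calc _ = E * ρ * s₃ * s₉ / (s₂ * s₅ * s₆ * s₇ * s₈ * s₁₀) / (s₁ * s₄)
        * (t₁ * t₂ * ((-1) ^ M * Φ)) := by ring
    _ = E * ρ * s₃ * s₉ / (s₂ * s₅ * s₆ * s₇ * s₈ * s₁₀) * (s₁ * s₄ * I) := by
      have hs₁ : s₁⁻¹ * s₁ ^ 2 = s₁ := by rw [sq, inv_mul_cancel_left₀ n1]
      have hs₄ : s₄⁻¹ * s₄ ^ 2 = s₄ := by rw [sq, inv_mul_cancel_left₀ n2]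
      rw [hphi]
      linear_combination E * ρ * s₃ * s₉ / (s₂ * s₅ * s₆ * s₇ * s₈ * s₁₀) * I
        * (s₄⁻¹ * s₄ ^ 2 * hs₁ + s₁ * hs₄)
    _ = _ := by ring

end Formulas

/-! ### Real deformation parameter -/

section Real

variable {h : ℂ} {r : ℕ → ℂ} {M A B : ℕ}

theorem conj_qpow (hh : h.im = 0) (x : ℚ) : starRingEnd ℂ (qpow h x) = qpow h x := by
  rw [qpow, ← Complex.exp_conj, map_mul, Complex.conj_eq_iff_im.2 hh, map_ratCast]

theorem conj_qnum (hh : h.im = 0) (x : ℚ) : starRingEnd ℂ (qnum h x) = qnum h x := by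
  simp [qnum, conj_qpow hh]

theorem conj_natQFact (hh : h.im = 0) (n : ℕ) : starRingEnd ℂ (natQFact h n) = natQFact h n := by
  simp [natQFact, conj_qnum hh]

theorem conj_qDescFact (hh : h.im = 0) (x : ℚ) (n : ℕ) :
    starRingEnd ℂ (qDescFact h x n) = qDescFact h x n := by
  simp [qDescFact, conj_qnum hh]

theorem conj_natSqFact (hrr : ∀ k, starRingEnd ℂ (r k) = r k) (n : ℕ) :
    starRingEnd ℂ (natSqFact r n) = natSqFact r n := by
  simp [natSqFact, hrr]

theorem conj_cgNat (hh : h.im = 0) (hrr : ∀ k, starRingEnd ℂ (r k) = r k) (k₁ k₂ i : ℕ) :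
    starRingEnd ℂ (cgNat h r M A B k₁ k₂ i) = cgNat h r M A B k₁ k₂ i := by
  rw [cgNat]
  split_ifs
  · simp [cgConst, cgInner, conj_qpow hh, conj_natQFact hh, conj_qDescFact hh,
      conj_natSqFact hrr, hrr]
  · simp

/-- The positive real numbers inside `ℂ`. -/
def IsPosReal (z : ℂ) : Prop := ∃ x : ℝ, 0 < x ∧ z = x

theorem IsPosReal.mul {z w : ℂ} (hz : IsPosReal z) (hw : IsPosReal w) : IsPosReal (z * w) := by
  obtain ⟨x, hx, rfl⟩ := hz
  obtain ⟨y, hy, rfl⟩ := hw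
  exact ⟨x * y, mul_pos hx hy, by push_cast; rfl⟩

theorem IsPosReal.div {z w : ℂ} (hz : IsPosReal z) (hw : IsPosReal w) : IsPosReal (z / w) := by
  obtain ⟨x, hx, rfl⟩ := hz
  obtain ⟨y, hy, rfl⟩ := hw
  exact ⟨x / y, div_pos hx hy, by push_cast; rfl⟩

theorem isPosReal_qpow (hh : h.im = 0) (x : ℚ) : IsPosReal (qpow h x) := by
  refine ⟨Real.exp (h.re * x), Real.exp_pos _, ?_⟩
  have : h = (h.re : ℂ) := Complex.ext rfl (by simpa using hh)
  rw [qpow, this]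
  push_cast
  simp

theorem isPosReal_natSqFact {N n : ℕ} (hpos : ∀ k, 1 ≤ k → k ≤ N → IsPosReal (r k))
    (hn : n ≤ N) : IsPosReal (natSqFact r n) := by
  induction n with
  | zero => exact ⟨1, one_pos, by simp⟩
  | succ n ih =>
    rw [natSqFact_succ]
    exact (ih (by omega)).mul (hpos _ (by omega) hn)

/-- No estimate of [k] is needed: r k is a nonnegative real whose square is nonzero. -/
theorem isPosReal_of_eq_sqrt (hr : ∀ k : ℕ, r k ^ 2 = qnum h k)
    (hsq : ∀ k : ℕ, r k = ((√(qnum h k).re : ℝ) : ℂ)) {k : ℕ} (hk : qnum h k ≠ 0) :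
    IsPosReal (r k) := by
  refine ⟨√(qnum h k).re, lt_of_le_of_ne (Real.sqrt_nonneg _) fun h0 => hk ?_, hsq k⟩
  rw [← hr, hsq, ← h0]
  simp

theorem isPosReal_cgVec_refIdx (hh : h.im = 0) (hr : ∀ k : ℕ, r k ^ 2 = qnum h k)
    (hq : ∀ k : ℕ, 1 ≤ k → k ≤ M + A + B + 1 → qnum h k ≠ 0)
    (hsq : ∀ k : ℕ, r k = ((√(qnum h k).re : ℝ) : ℂ)) :
    IsPosReal (cgVec h r M A B (A + B) (refIdx (M + B) (M + A) (A + B))) := by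
  have hpos : ∀ k, 1 ≤ k → k ≤ M + A + B + 1 → IsPosReal (r k) := fun k h1 h2 =>
    isPosReal_of_eq_sqrt hr hsq (hq k h1 h2)
  have hs : ∀ n, n ≤ M + A + B + 1 → IsPosReal (natSqFact r n) := fun n =>
    isPosReal_natSqFact hpos
  have hf : ∀ n, n ≤ M + A + B + 1 → IsPosReal (natQFact h n) := fun n hn => by
    rw [← natSqFact_sq hr, sq]
    exact (hs n hn).mul (hs n hn)
  -- The reference coordinate is the case T = M, U = 0 of the product formula, where the sign (-1)^U
  -- is 1.
  have htop := cgNat_top (A := A) (B := B) hr hq (show M + 0 = M from rfl)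
  rw [pow_zero, one_mul] at htop
  rw [cgVec, refIdx_eq]
  simp only [Fin.val_last]
  rw [add_comm M B]
  refine htop ▸ ?_
  exact ((((((hpos _ (by omega) (by omega)).mul (hs _ (by omega))).mul (hs _ (by omega))).mul
    (hs _ (by omega))).div (hs _ (by omega))).mul (hs _ (by omega))).div
    ((hf _ (by omega)).mul (hf _ (by omega))) |>.mul ((isPosReal_qpow hh _).mul
    (((hs _ (by omega)).mul (hs _ (by omega))).div ((hs _ (by omega)).mul (hs _ (by omega)))))

theorem star_cgVec (hh : h.im = 0) (hrr : ∀ k, starRingEnd ℂ (r k) = r k) (i : ℕ) :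
    star (cgVec h r M A B i) = cgVec h r M A B i := by
  ext p
  exact conj_cgNat hh hrr _ _ _

end Real

/-! ### Coupled bases compared with the explicit one -/

section Main

variable {h : ℂ} {r : ℕ → ℂ} {M A B : ℕ}

theorem IsCanonicalBasis.eq_smul_cgVec {v : Fin (A + B + 1) → _}
    (hv : IsCanonicalBasis h r (A + B) (deltaQJ0 h (M + B) (M + A))
      (deltaJplus h r (M + B) (M + A)) (deltaJminus h r (M + B) (M + A)) v)
    (hr : ∀ k : ℕ, r k ^ 2 = qnum h k)
    (hq : ∀ k : ℕ, 1 ≤ k → k ≤ M + A + B + 1 → qnum h k ≠ 0) (i : Fin (A + B + 1)) :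
    v i = (v (Fin.last _) (refIdx (M + B) (M + A) (A + B))
      / cgVec h r M A B (A + B) (refIdx (M + B) (M + A) (A + B))) • cgVec h r M A B i :=
  have hw := cgVec_isCoupledBasis (M := M) hr hq
  hv.eq_smul hw.canonical hr hq (hw.apply_refIdx_ne_zero hr hq) i

theorem IsCoupledBasis.exists_sign {v : Fin (A + B + 1) → _}
    (hv : IsCoupledBasis h r (M + B) (M + A) (A + B) v)
    (hr : ∀ k : ℕ, r k ^ 2 = qnum h k)
    (hq : ∀ k : ℕ, 1 ≤ k → k ≤ M + A + B + 1 → qnum h k ≠ 0) :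
    ∃ ε : ℂ, (ε = 1 ∨ ε = -1) ∧ ∀ i : Fin (A + B + 1), v i = ε • cgVec h r M A B i := by
  have hscal := hv.canonical.eq_smul_cgVec hr hq
  refine ⟨_, mul_self_eq_one_iff.1 ?_, hscal⟩
  have hn := hv.orthonormal (Fin.last _) (Fin.last _)
  rwa [if_pos rfl, hscal, smul_dotProduct, dotProduct_smul, Fin.val_last, cgVec_top_norm hr hq,
    smul_eq_mul, smul_eq_mul, mul_one] at hn

theorem IsUnitaryCoupledBasis.eq_cgVec {v : Fin (A + B + 1) → _}
    (hv : IsUnitaryCoupledBasis h r (M + B) (M + A) (A + B) v) (hh : h.im = 0)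
    (hr : ∀ k : ℕ, r k ^ 2 = qnum h k)
    (hq : ∀ k : ℕ, 1 ≤ k → k ≤ M + A + B + 1 → qnum h k ≠ 0)
    (hsq : ∀ k : ℕ, r k = ((√(qnum h k).re : ℝ) : ℂ)) (i : Fin (A + B + 1)) :
    v i = cgVec h r M A B i := by
  have hrr : ∀ k, starRingEnd ℂ (r k) = r k := fun k => by
    rw [hsq]
    exact Complex.conj_ofReal _
  have hpos : IsPosReal (v (Fin.last _) (refIdx (M + B) (M + A) (A + B))) :=
    ⟨_, hv.phase.1, Complex.ext rfl hv.phase.2⟩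
  have hscal := hv.canonical.eq_smul_cgVec hr hq
  obtain ⟨x, hx, hx'⟩ := hpos.div (isPosReal_cgVec_refIdx (M := M) (A := A) (B := B) hh hr hq hsq)
  rw [hx'] at hscal
  have hn := hv.orthonormal (Fin.last _) (Fin.last _)
  rw [if_pos rfl, hscal, star_smul, star_cgVec hh hrr, smul_dotProduct, dotProduct_smul,
    Fin.val_last, cgVec_top_norm hr hq, smul_eq_mul, smul_eq_mul, mul_one] at hn
  have hn' : x * x = 1 := by
    have : star (x : ℂ) = x := Complex.conj_ofReal x
    rw [this] at hn
    exact_mod_cast hn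
  have : x = 1 := by nlinarith
  rw [hscal, this, Complex.ofReal_one, one_smul]

theorem cgVec_isUnitaryCoupledBasis (hh : h.im = 0)
    (hr : ∀ k : ℕ, r k ^ 2 = qnum h k)
    (hq : ∀ k : ℕ, 1 ≤ k → k ≤ M + A + B + 1 → qnum h k ≠ 0)
    (hsq : ∀ k : ℕ, r k = ((√(qnum h k).re : ℝ) : ℂ)) :
    IsUnitaryCoupledBasis h r (M + B) (M + A) (A + B) fun i => cgVec h r M A B i := by
  have hrr : ∀ k, starRingEnd ℂ (r k) = r k := fun k => by
    rw [hsq]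
    exact Complex.conj_ofReal _
  have hw := cgVec_isCoupledBasis (M := M) hr hq
  refine ⟨hw.canonical, fun i k => ?_, ?_⟩
  · rw [star_cgVec hh hrr]
    exact hw.orthonormal i k
  · obtain ⟨x, hx, hx'⟩ := isPosReal_cgVec_refIdx (M := M) (A := A) (B := B) hh hr hq hsq
    rw [Fin.val_last, hx']
    exact ⟨hx, Complex.ofReal_im x⟩

end Main

end UqSU2

theorem mainTheorem6 (h : ℂ) (r : ℕ → ℂ) (hr : ∀ k : ℕ, r k ^ 2 = UqSU2.qnum h k)
    (a b c : ℕ) (hpar : Even (a + b + c)) (hab : a ≤ b + c) (hba : b ≤ a + c) (hc : c ≤ a + b)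
    (hq : ∀ k : ℕ, 1 ≤ k → k ≤ (a + b + c) / 2 + 1 → UqSU2.qnum h k ≠ 0) :
    ((∃ v, UqSU2.IsCoupledBasis h r a b c v) ∧
      ∀ v, UqSU2.IsCoupledBasis h r a b c v →
        (∃ ε : ℂ, (ε = 1 ∨ ε = -1) ∧
          ∀ (i₁ : Fin (a + 1)) (i₂ : Fin (b + 1)) (i₃ : Fin (c + 1)),
            v i₃ (i₁, i₂) = ε * UqSU2.cgSum h r (UqSU2.spin a) (UqSU2.wt a i₁)
              (UqSU2.spin b) (UqSU2.wt b i₂) (UqSU2.spin c) (UqSU2.wt c i₃) ∧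
            v i₃ (i₁, i₂) = ε * UqSU2.cgPhi h r (UqSU2.spin a) (UqSU2.wt a i₁)
              (UqSU2.spin b) (UqSU2.wt b i₂) (UqSU2.spin c) (UqSU2.wt c i₃)) ∧
        (∃ s : ℂ, s ≠ 0 ∧
          s ^ 2 = UqSU2.projElem h r a b c (UqSU2.refIdx a b c).1 (UqSU2.refIdx a b c).2
            (Fin.last c) ∧
          ∀ (i₁ : Fin (a + 1)) (i₂ : Fin (b + 1)) (i₃ : Fin (c + 1)),
            v i₃ (i₁, i₂) = UqSU2.projElem h r a b c i₁ i₂ i₃ / s)) ∧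
    (h.im = 0 → (∀ k : ℕ, r k = ((√(UqSU2.qnum h k).re : ℝ) : ℂ)) →
      (∃ v, UqSU2.IsUnitaryCoupledBasis h r a b c v) ∧
      ∀ v, UqSU2.IsUnitaryCoupledBasis h r a b c v →
        (0 < (UqSU2.projElem h r a b c (UqSU2.refIdx a b c).1 (UqSU2.refIdx a b c).2
          (Fin.last c)).re) ∧
        ∀ (i₁ : Fin (a + 1)) (i₂ : Fin (b + 1)) (i₃ : Fin (c + 1)),
          v i₃ (i₁, i₂) = UqSU2.cgSum h r (UqSU2.spin a) (UqSU2.wt a i₁)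
            (UqSU2.spin b) (UqSU2.wt b i₂) (UqSU2.spin c) (UqSU2.wt c i₃) ∧
          v i₃ (i₁, i₂) = UqSU2.cgPhi h r (UqSU2.spin a) (UqSU2.wt a i₁)
            (UqSU2.spin b) (UqSU2.wt b i₂) (UqSU2.spin c) (UqSU2.wt c i₃) ∧
          v i₃ (i₁, i₂) = UqSU2.projElem h r a b c i₁ i₂ i₃ /
            ((√(UqSU2.projElem h r a b c (UqSU2.refIdx a b c).1 (UqSU2.refIdx a b c).2
              (Fin.last c)).re : ℝ) : ℂ)) := by
  -- With S = j₁+j₂+j₃, these are S - 2j₃, S - 2j₁ and S - 2j₂.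
  obtain ⟨M, A, B, rfl, rfl, rfl⟩ : ∃ M A B, a = M + B ∧ b = M + A ∧ c = A + B := by
    obtain ⟨S, hS⟩ := hpar
    exact ⟨S - c, S - a, S - b, by omega, by omega, by omega⟩
  have hq : ∀ k : ℕ, 1 ≤ k → k ≤ M + A + B + 1 → UqSU2.qnum h k ≠ 0 := fun k h1 h2 =>
    hq k h1 (by omega)
  have hw := UqSU2.cgVec_isCoupledBasis (M := M) hr hq
  refine ⟨⟨⟨_, hw⟩, fun v hv => ⟨?_, ?_⟩⟩, fun hh hsq =>
    ⟨⟨_, UqSU2.cgVec_isUnitaryCoupledBasis hh hr hq hsq⟩, fun v hv => ?_⟩⟩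
  · obtain ⟨ε, hε, hv'⟩ := hv.exists_sign hr hq
    refine ⟨ε, hε, fun i₁ i₂ i₃ => ?_⟩
    rw [UqSU2.cgSum_eq hr hq, UqSU2.cgPhi_eq hr hq, hv']
    exact ⟨rfl, rfl⟩
  · have href := hv.apply_refIdx_ne_zero hr hq
    -- The square root s of D is the reference coordinate of the top vector of v.
    refine ⟨_, href, ?_, fun i₁ i₂ i₃ => ?_⟩
    · rw [hv.projElem_eq hr hq, sq]
    · rw [hv.projElem_eq hr hq, mul_div_cancel_right₀ _ href]
  · have hv' := hv.eq_cgVec hh hr hq hsq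
    obtain ⟨x, hx, hx'⟩ :=
      UqSU2.isPosReal_cgVec_refIdx (M := M) (A := A) (B := B) hh hr hq hsq
    have hD : UqSU2.projElem h r (M + B) (M + A) (A + B)
        (UqSU2.refIdx (M + B) (M + A) (A + B)).1 (UqSU2.refIdx (M + B) (M + A) (A + B)).2
        (Fin.last (A + B)) = ((x * x : ℝ) : ℂ) := by
      rw [hw.projElem_eq hr hq, Fin.val_last, hx', Complex.ofReal_mul]
    rw [hD, Complex.ofReal_re, Real.sqrt_mul_self hx.le]
    refine ⟨mul_pos hx hx, fun i₁ i₂ i₃ => ?_⟩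
    have hx0 : (x : ℂ) ≠ 0 := Complex.ofReal_ne_zero.2 hx.ne'
    rw [UqSU2.cgSum_eq hr hq, UqSU2.cgPhi_eq hr hq, hw.projElem_eq hr hq, Fin.val_last, hx',
      mul_div_cancel_right₀ _ hx0, hv']
    exact ⟨rfl, rfl, rfl⟩
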